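/- Let $\alpha\in(0,2)$ and let $\xi$ be a symmetric real random variable (i.e. $\xi\stackrel{d}{=}-\xi$) with regularly varying tail of index $\alpha$: $\mathbb P(|\xi|>x)=x^{-\alpha}L(x)$ for all $x>0$, where $L:(0,\infty)\to(0,\infty)$ is slowly varying at infinity, that is, $L(tx)/L(x)\to1$ as $x\to\infty$ for every $t>0$. Let $X_1,X_2,\dots$ be independent copies of $\xi$ and let $\mathbf y^{(n)}=(Y_1,\dots,Y_n)^\top$ with $Y_i=X_i/\sqrt{X_1^2+\cdots+X_n^2}$ (and $\mathbf y^{(n)}=0$ on the event $X_1=\cdots=X_n=0$). Let $\mathbf A_n=(a_{ij}^{(n)})_{i,j=1}^n$, $n\ge1$, be random Hermitian $n\times n$ matrices, defined on the same probability space, such that $\mathbf A_n$ is independent of $\mathbf y^{(n)}$ for each $n$. Put $Q_{n,1}=(\mathbf y^{(n)})^\top\operatorname{diag}(\mathbf A_n)\,\mathbf y^{(n)}$. Assume that $M:=\limsup_{n\to\infty}\max_{1\le i\le n}|a_{ii}^{(n)}|<\infty$ almost surely (a possibly random quantity), and that $\frac1n\sum_{i=1}^n\delta_{a_{ii}^{(n)}}$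 converges weakly, almost surely, to a deterministic probability measure $\nu$ on $\mathbb R$. Then there is a probability measure $\mu_{\nu,\alpha}$ on $\mathbb R$ such that: 1. $Q_{n,1}$ converges in distribution, as $n\to\infty$, to a random variable with law $\mu_{\nu,\alpha}$. 2. For every $z\in\mathbb C$ outside the convex hull (in $\mathbb R$) of $\operatorname{supp}(\nu)$, the point $z$ lies outside $\operatorname{supp}(\mu_{\nu,\alpha})$ and the Stieltjes transform satisfies $$s_{\mu_{\nu,\alpha}}(z)=\int_{\mathbb R}\frac{1}{x-z}\,\mu_{\nu,\alpha}(dx)=-\frac{\int_{\mathbb R}(z-x)^{\frac{\alpha}{2}-1}\,\nu(dx)}{\int_{\mathbb R}(z-x)^{\frac{\alpha}{2}}\,\nu(dx)},$$ with principal branches of the powers (branch cut along $(-\infty,0]$, $\arg=\pi$ on the negative half-line), both integrals on the right converging absolutely and the denominator being non-zero. 3. All moments of $\mu_{\nu,\alpha}$ are finite and, for $\ell\ge1$, $\int_{\mathbb R}x^\ell\,\mu_{\nu,\alpha}(dx)=m_\ell$, where $$m_\ell=\sum_{r=1}^{\ell}\Big(\frac{\alpha}{2}\Big)^{r-1}\frac{\ell}{r\,\Gamma(1-\frac{\alpha}{2})^r}\sum_{\substack{\ell_1,\dots,\ell_r\ge1\\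 \ell_1+\cdots+\ell_r=\ell}}\ \prod_{s=1}^r\frac{\Gamma(\ell_s-\frac{\alpha}{2})}{\ell_s!}\int_{\mathbb R}x^{\ell_s}\,\nu(dx).$$ Moreover $\mu_{\nu,\alpha}$ is the only probability measure on $\mathbb R$ with these moments. 4. Almost surely, $\operatorname{supp}(\mu_{\nu,\alpha})\subseteq[-M,M]$. -/

import Mathlib

open MeasureTheory ProbabilityTheory Filter
open scoped Topology ENNReal NNReal

noncomputable section

namespace HeavyTailedQF

/-- `L : (0, ∞) → (0, ∞)` is slowly varying at infinity: `L (t x) / L x → 1` as `x → ∞`, for all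
`t > 0`. Only the values of `L` on `(0, ∞)` matter. -/
def IsSlowlyVarying (L : ℝ → ℝ) : Prop :=
  (∀ x : ℝ, 0 < x → 0 < L x) ∧
    ∀ t : ℝ, 0 < t → Tendsto (fun x : ℝ => L (t * x) / L x) atTop (𝓝 1)

/-- The random variable `ξ` has a regularly varying tail with index `α`:
`P(|ξ| > x) = x ^ (-α) * L x` for all `x > 0`, with `L` slowly varying at infinity. -/
def HasRegularlyVaryingTail {Ω : Type*} [MeasurableSpace Ω] (P : Measure Ω) (ξ : Ω → ℝ)
    (α : ℝ) : Prop :=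
  ∃ L : ℝ → ℝ, IsSlowlyVarying L ∧
    ∀ x : ℝ, 0 < x → P.real {ω | x < |ξ ω|} = x ^ (-α) * L x

/-- The self-normalized vector with components `X i / √(X 0 ^ 2 + ⋯ + X (n - 1) ^ 2)`, `i < n`
(the zero vector on the event that `X 0, …, X (n - 1)` all vanish). -/
def selfNormalized {Ω : Type*} (X : ℕ → Ω → ℝ) (n : ℕ) (ω : Ω) : Fin n → ℝ :=
  fun i => X i ω / √(∑ j : Fin n, X j ω ^ 2)

/-- The quadratic form `yᵀ B y` of a real vector `y` and a complex matrix `B`. -/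
def quadForm {n : ℕ} (y : Fin n → ℝ) (B : Matrix (Fin n) (Fin n) ℂ) : ℂ :=
  (fun i => (y i : ℂ)) ⬝ᵥ (B.mulVec fun i => (y i : ℂ))

/-- The diagonal quadratic form `yᵀ diag(B) y`, as a real number. The real part loses nothing for
a Hermitian `B`, see `ofReal_diagQuadForm`. -/
def diagQuadForm {n : ℕ} (y : Fin n → ℝ) (B : Matrix (Fin n) (Fin n) ℂ) : ℝ :=
  (quadForm y (Matrix.diagonal B.diag)).re

theorem quadForm_diagonal {n : ℕ} (y : Fin n → ℝ) (d : Fin n → ℂ) :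
    quadForm y (Matrix.diagonal d) = ∑ i, d i * (y i : ℂ) ^ 2 := by
  simp only [quadForm, dotProduct, Matrix.mulVec_diagonal]
  exact Finset.sum_congr rfl fun i _ => by ring

theorem ofReal_diagQuadForm {n : ℕ} (y : Fin n → ℝ) (B : Matrix (Fin n) (Fin n) ℂ)
    (hB : B.IsHermitian) :
    (diagQuadForm y B : ℂ) = quadForm y (Matrix.diagonal B.diag) := by
  rw [diagQuadForm, quadForm_diagonal, Complex.re_sum, Complex.ofReal_sum]
  refine Finset.sum_congr rfl fun i _ => ?_
  have h := hB.coe_re_apply_self i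
  simp only [Matrix.diag_apply]
  rw [← h]
  simp [← Complex.ofReal_pow, ← Complex.ofReal_mul]

/-- The empirical measure `n⁻¹ ∑ i, δ_{B i i}` of the (real) diagonal entries of a Hermitian
matrix `B` of size `n`; a probability measure for `n ≥ 1`, and the zero measure for `n = 0`. -/
def empiricalDiag {n : ℕ} (B : Matrix (Fin n) (Fin n) ℂ) : FiniteMeasure ℝ :=
  ⟨((n : ℝ≥0)⁻¹) • ∑ i : Fin n, Measure.dirac (B i i).re, inferInstance⟩

/-- `limsup_{n → ∞} max_{i ≤ n} |a_{ii}^{(n)}|`, as an element of `[0, ∞]`. -/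
def diagLimsup (B : (n : ℕ) → Matrix (Fin n) (Fin n) ℂ) : ℝ≥0∞ :=
  limsup (fun n : ℕ => ⨆ i : Fin n, ‖B n i i‖ₑ) atTop

/-- The Stieltjes transform `s_μ(z) = ∫ (x - z)⁻¹ μ(dx)`, for `z` outside the support of `μ`. -/
def stieltjesTransform (μ : Measure ℝ) (z : ℂ) : ℂ :=
  resolventTransform μ z

theorem stieltjesTransform_eq (μ : Measure ℝ) (z : ℂ) :
    stieltjesTransform μ z = ∫ x : ℝ, 1 / ((x : ℂ) - z) ∂μ := by
  simp [stieltjesTransform, resolventTransform_def, resolvent, one_div]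

/-- The tuples `(ℓ₁, …, ℓ_r)` of integers `≥ 1` with `ℓ₁ + ⋯ + ℓ_r = ℓ`. -/
def compositions (r ℓ : ℕ) : Finset (Fin r → ℕ) :=
  (Finset.Nat.antidiagonalTuple r ℓ).filter fun k => ∀ s, 1 ≤ k s

/-- The numbers
`m_ℓ = ∑_{r=1}^ℓ (α/2)^(r-1) * ℓ / (r Γ(1-α/2)^r) *
  ∑_{ℓ₁+⋯+ℓ_r=ℓ, ℓ_s ≥ 1} ∏_s Γ(ℓ_s-α/2) / ℓ_s! * ∫ x^{ℓ_s} ν(dx)`. -/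
def limitMoment (ν : Measure ℝ) (α : ℝ) (ℓ : ℕ) : ℝ :=
  ∑ r ∈ Finset.Icc 1 ℓ,
    (α / 2) ^ (r - 1) * ((ℓ : ℝ) / ((r : ℝ) * Real.Gamma (1 - α / 2) ^ r)) *
      ∑ k ∈ compositions r ℓ,
        ∏ s : Fin r, (Real.Gamma ((k s : ℝ) - α / 2) / (Nat.factorial (k s) : ℝ) *
          ∫ x : ℝ, x ^ (k s) ∂ν)

end HeavyTailedQF

end

/-!
Write `a = α / 2`, `W i = X i ^ 2`. The quadratic form is the self-normalized weighted sum
`Q = ∑ b i * W i / ∑ W i`, where the `b i` are the diagonal entries, and, by independence, these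
weights may be frozen. The variables `W i` are nonnegative and have a regularly varying tail of
index `-a` with `0 < a < 1`.

*The transform of the limit.* For small real `w` the variable `1 - w Q` is the ratio `T / S` with
`S = ∑ W i` and `T = ∑ (1 - w * b i) * W i`, all weights of `T` being positive. Writing
`1 / T = ∫ exp (-l T) dl`, the mean of `(S - c T) / T` becomes the integral over `l` of
`E[(S - c T) exp (-l T)]`. By independence this quantity is, up to a positive factor that it shares
with `E[T exp (-l T)]`, a weighted sum of values at `l * (1 - w * b i)` of the logarithmic
derivative of the Laplace transform of `W 0`. Near the origin that derivative is regularly varying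
of index `a - 1`, uniformly on compact sets of arguments (`eventually_abs_logDeriv_laplace_sub_le`).
Hence `E[(S - c T) exp (-l T)]` is negligible relative to `E[T exp (-l T)]`, whose integral over
`l` is at most `1`, as soon as `c` is the quotient of the limiting averages of
`(1 - w * b i) ^ (a - 1)` and `(1 - w * b i) ^ a`. This gives `E[S / T] → c`
(`tendsto_integral_sum_div_sum`): no normalizing sequence and no stable limit law is needed. A
limit law `μ` of `Q` therefore satisfies, for small real `w`,
`∫ (1 - w x)⁻¹ dμ * ∫ (1 - w x) ^ a dν = ∫ (1 - w x) ^ (a - 1) dν` (`TransformRelation`).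

*Consequences of the relation.* Comparing Taylor coefficients in `w` determines all the moments of
`μ` (`integral_pow_eq_limitMoment`), and these determine `μ` (`eq_of_forall_integral_pow_eq`).
With `z = 1 / w`, the identity theorem extends the relation from large real `z` to the formula for
the Stieltjes transform (`stieltjesTransform_eq_of_relation`).

*Existence and convergence.* The laws of `Q` live on a compact interval, so they have cluster
points, and the relation forces all of these to agree (`tendsto_weightedMeanLaw`). Clamping the
weights to the convex hull of the support of `ν` does not affect their limiting distribution;
this shows that `μ` lives on that interval (`exists_transformRelation`). The bound on the support
of `μ` follows because `ν` itself lives on `[-M, M]`.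
-/

open MeasureTheory ProbabilityTheory Filter
open scoped Topology ENNReal NNReal BoundedContinuousFunction

noncomputable section

namespace HeavyTailedQF

/-! ### Regularly varying tails -/

/-- `F` is the tail function `x ↦ P(W > x)` of an unbounded nonnegative random variable and is
regularly varying at infinity with index `-a`. -/
structure IsRegularTail (F : ℝ → ℝ) (a : ℝ) : Prop where
  anti : Antitone F
  pos : ∀ x, 0 < F x
  le_one : ∀ x, F x ≤ 1
  tendsto_ratio : ∀ t : ℝ, 0 < t → Tendsto (fun x => F (t * x) / F x) atTop (𝓝 (t ^ (-a)))

/-- Potter's bound towards the origin. Since `F` is monotone, it is enough to compare `F` at `x`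
and `x / 2` and to iterate. -/
theorem IsRegularTail.potter {F : ℝ → ℝ} {a p : ℝ} (hF : IsRegularTail F a) (hp : 0 < p)
    (hap : a < p) :
    ∃ C x₀ : ℝ, 0 < C ∧ 0 < x₀ ∧ ∀ x, x₀ ≤ x → ∀ u, 0 < u → u ≤ 1 →
      F (u * x) ≤ C * u ^ (-p) * F x := by
  have h2 : ((1 / 2 : ℝ)) ^ (-a) < 2 ^ p := by
    rw [one_div, Real.inv_rpow (by norm_num), Real.rpow_neg (by norm_num), inv_inv]
    exact Real.rpow_lt_rpow_of_exponent_lt (by norm_num) hap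
  have hev := (hF.tendsto_ratio (1 / 2) (by norm_num)).eventually (gt_mem_nhds h2)
  obtain ⟨x₁, hx₁⟩ := eventually_atTop.1 hev
  set x₀ := max x₁ 1 with hx₀
  have hx0 : 0 < x₀ := lt_of_lt_of_le one_pos (le_max_right _ _)
  have hhalf : ∀ x, x₀ ≤ x → F (x / 2) ≤ 2 ^ p * F x := by
    intro x hx
    have := hx₁ x (le_trans (le_max_left _ _) hx)
    rw [div_lt_iff₀ (hF.pos x)] at this
    rw [show x / 2 = 1 / 2 * x by ring]
    exact this.le
  -- `G` is almost increasing
  set G : ℝ → ℝ := fun x => x ^ p * F x with hG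
  have h2p : (1 : ℝ) ≤ 2 ^ p := Real.one_le_rpow (by norm_num) hp.le
  have hGpos : ∀ x, 0 < x → 0 < G x := fun x hx => mul_pos (Real.rpow_pos_of_pos hx _) (hF.pos x)
  have key : ∀ k : ℕ, ∀ y x, x₀ ≤ y → y ≤ x → x ≤ 2 ^ k * y → G y ≤ 2 ^ p * G x := by
    have near : ∀ y x, x₀ ≤ y → y ≤ x → x ≤ 2 * y → G y ≤ 2 ^ p * G x := by
      intro y x hy hyx hxy
      have h1 : F y ≤ 2 ^ p * F x :=
        (hF.anti (by linarith : x / 2 ≤ y)).trans (hhalf x (hy.trans hyx))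
      have h3 : y ^ p ≤ x ^ p := Real.rpow_le_rpow (hx0.le.trans hy) hyx hp.le
      calc G y ≤ x ^ p * (2 ^ p * F x) :=
            mul_le_mul h3 h1 (hF.pos y).le (Real.rpow_nonneg (hx0.le.trans (hy.trans hyx)) _)
        _ = 2 ^ p * G x := by simp only [hG]; ring
    intro k
    induction k with
    | zero => intro y x hy hyx hxy; exact near y x hy hyx (by linarith)
    | succ k ih =>
      intro y x hy hyx hxy
      rcases le_total x (2 * y) with h | h
      · exact near y x hy hyx h
      · have h1 := ih y (x / 2) hy (by linarith) (by rw [pow_succ] at hxy; linarith)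
        have hx : 0 < x := by linarith
        have h3 : G (x / 2) ≤ G x := by
          simp only [hG]
          rw [Real.div_rpow hx.le (by norm_num), div_mul_eq_mul_div,
            div_le_iff₀ (by positivity)]
          have := hhalf x (hy.trans hyx)
          have h4 := Real.rpow_pos_of_pos hx p
          nlinarith
        exact h1.trans (by gcongr)
  have key' : ∀ y x, x₀ ≤ y → y ≤ x → G y ≤ 2 ^ p * G x := by
    intro y x hy hyx
    have hy0 : 0 < y := lt_of_lt_of_le hx0 hy
    obtain ⟨k, hk⟩ := pow_unbounded_of_one_lt (x / y) (by norm_num : (1 : ℝ) < 2)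
    rw [div_lt_iff₀ hy0] at hk
    exact key k y x hy hyx hk.le
  -- below `x₀` only the trivial bound `F ≤ 1` is available; `D` absorbs it
  set D := max 1 (x₀ ^ p / G x₀) with hD
  refine ⟨D * 2 ^ p, x₀, by positivity, hx0, fun x hx u hu hu1 => ?_⟩
  have hxpos : 0 < x := lt_of_lt_of_le hx0 hx
  have hux : 0 < u * x := mul_pos hu hxpos
  suffices h : G (u * x) ≤ D * 2 ^ p * G x by
    simp only [hG] at h
    rw [Real.mul_rpow hu.le hxpos.le] at h
    have hxp := Real.rpow_pos_of_pos hxpos p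
    have hup := Real.rpow_pos_of_pos hu p
    have h' : u ^ p * F (u * x) ≤ D * 2 ^ p * F x := by
      refine le_of_mul_le_mul_left ?_ hxp
      linarith
    rw [Real.rpow_neg hu.le, mul_assoc, mul_comm (u ^ p)⁻¹, ← mul_assoc, ← div_eq_mul_inv,
      le_div_iff₀ hup]
    linarith
  rcases le_total x₀ (u * x) with h | h
  · refine (key' _ x h (by nlinarith)).trans ?_
    have h1 : 1 ≤ D := le_max_left _ _
    have h3 := hGpos x hxpos
    have : 0 < (2 : ℝ) ^ p * G x := by positivity
    nlinarith
  · calc G (u * x) ≤ x₀ ^ p * 1 :=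
          mul_le_mul (Real.rpow_le_rpow hux.le h hp.le) (hF.le_one _) (hF.pos _).le (by positivity)
      _ = x₀ ^ p / G x₀ * G x₀ := by rw [div_mul_cancel₀ _ (hGpos x₀ hx0).ne', mul_one]
      _ ≤ D * (2 ^ p * G x) :=
          mul_le_mul (le_max_right _ _) (key' x₀ x le_rfl hx) (hGpos x₀ hx0).le (by positivity)
      _ = _ := by ring

/-- Weighted `L¹` convergence of the rescaled tail to the power function, by dominated convergence:
the ratio is at most `1` for `u ≥ 1`, and Potter's bound with an exponent `p < 1` covers `u ≤ 1`. -/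
theorem IsRegularTail.tendsto_integral_abs_sub {F : ℝ → ℝ} {a : ℝ} (hF : IsRegularTail F a)
    (ha0 : 0 < a) (ha1 : a < 1) {b₀ : ℝ} (B : ℝ) (hb₀ : 0 < b₀) (hB : 0 ≤ B) :
    Tendsto (fun l : ℝ => ∫ u in Set.Ioi (0 : ℝ),
      ((1 + B * u) * Real.exp (-(b₀ * u))) * |F (u / l) / F (1 / l) - u ^ (-a)|)
      (𝓝[>] 0) (𝓝 0) := by
  obtain ⟨p, hap, hp1⟩ := exists_between ha1
  obtain ⟨C, x₀, hC, hx₀, hpot⟩ := hF.potter (ha0.trans hap) hap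
  have hinv : Tendsto (fun l : ℝ => 1 / l) (𝓝[>] 0) atTop := by
    simpa only [one_div] using tendsto_inv_nhdsGT_zero (𝕜 := ℝ)
  have hrp : ∀ s : ℝ, -1 < s → IntegrableOn (fun u : ℝ => u ^ s * Real.exp (-(b₀ * u)))
      (Set.Ioi 0) := by
    intro s hs
    simpa only [Real.rpow_one, neg_mul] using
      integrableOn_rpow_mul_exp_neg_mul_rpow (p := 1) hs one_pos hb₀
  have hmeasF : Measurable F := hF.anti.measurable
  have hlim : Tendsto (fun l : ℝ => ∫ u in Set.Ioi (0 : ℝ),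
      ((1 + B * u) * Real.exp (-(b₀ * u))) * |F (u / l) / F (1 / l) - u ^ (-a)|)
      (𝓝[>] 0) (𝓝 (∫ u in Set.Ioi (0 : ℝ), (0 : ℝ))) := by
    refine tendsto_integral_filter_of_dominated_convergence
      (fun u => (1 + B * u) * Real.exp (-(b₀ * u)) * (1 + C * u ^ (-p) + u ^ (-a))) ?_ ?_ ?_ ?_
    · refine Eventually.of_forall fun l => ?_
      have : Measurable fun u : ℝ => ((1 + B * u) * Real.exp (-(b₀ * u))) *
          |F (u / l) / F (1 / l) - u ^ (-a)| := by
        have h1 : Measurable fun u : ℝ => F (u / l) := hmeasF.comp (measurable_id.div_const l)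
        have h2 : Measurable fun u : ℝ => u ^ (-a) := measurable_id.pow_const _
        have h3 : Measurable fun u : ℝ => |F (u / l) / F (1 / l) - u ^ (-a)| :=
          ((h1.div_const _).sub h2).abs
        have h4 : Measurable fun u : ℝ => (1 + B * u) * Real.exp (-(b₀ * u)) := by fun_prop
        exact h4.mul h3
      exact this.aestronglyMeasurable
    · filter_upwards [hinv.eventually_ge_atTop x₀, self_mem_nhdsWithin] with l hl hl0
      refine (ae_restrict_iff' measurableSet_Ioi).2 (Eventually.of_forall fun u hu => ?_)
      have hu0 : (0 : ℝ) < u := hu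
      have hl0' : (0 : ℝ) < l := hl0
      have hF1 := hF.pos (1 / l)
      have hua : 0 < u ^ (-a) := Real.rpow_pos_of_pos hu0 _
      have hup : 0 < u ^ (-p) := Real.rpow_pos_of_pos hu0 _
      have hw : 0 ≤ (1 + B * u) * Real.exp (-(b₀ * u)) := by positivity
      rw [Real.norm_eq_abs, abs_mul, abs_of_nonneg hw, abs_abs]
      refine mul_le_mul_of_nonneg_left ?_ hw
      have hr0 : 0 < F (u / l) / F (1 / l) := div_pos (hF.pos _) hF1
      have hr : F (u / l) / F (1 / l) ≤ 1 + C * u ^ (-p) := by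
        rw [div_le_iff₀ hF1]
        rcases le_total u 1 with h | h
        · have := hpot (1 / l) hl u hu0 h
          rw [show u * (1 / l) = u / l by ring] at this
          linarith
        · have : F (u / l) ≤ F (1 / l) := hF.anti (by gcongr)
          have h2 : 0 < C * u ^ (-p) * F (1 / l) := by positivity
          linarith
      rw [abs_le]
      constructor <;> linarith [mul_pos hC hup]
    · have e : ∀ u ∈ Set.Ioi (0 : ℝ),
          (u ^ (0 : ℝ) * Real.exp (-(b₀ * u)) + C * (u ^ (-p) * Real.exp (-(b₀ * u))) +
            u ^ (-a) * Real.exp (-(b₀ * u)) + B * (u ^ (1 : ℝ) * Real.exp (-(b₀ * u))) +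
            B * C * (u ^ (-p + 1) * Real.exp (-(b₀ * u))) +
            B * (u ^ (-a + 1) * Real.exp (-(b₀ * u)))) =
          (1 + B * u) * Real.exp (-(b₀ * u)) * (1 + C * u ^ (-p) + u ^ (-a)) := by
        intro u hu
        have hu0 : (0 : ℝ) < u := hu
        rw [Real.rpow_zero, Real.rpow_one, Real.rpow_add_one hu0.ne', Real.rpow_add_one hu0.ne']
        ring
      refine IntegrableOn.congr_fun ?_ e measurableSet_Ioi
      have := hrp 0 (by norm_num)
      have h1 := hrp 1 (by norm_num)
      have h2 := hrp (-p) (by linarith)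
      have h3 := hrp (-a) (by linarith)
      have h4 := hrp (-p + 1) (by linarith)
      have h5 := hrp (-a + 1) (by linarith)
      exact ((((this.add (h2.const_mul C)).add h3).add (h1.const_mul B)).add
        (h4.const_mul (B * C))).add (h5.const_mul B)
    · refine (ae_restrict_iff' measurableSet_Ioi).2 (Eventually.of_forall fun u hu => ?_)
      have h1 := (hF.tendsto_ratio u hu).comp hinv
      have h2 : Tendsto (fun l : ℝ => F (u / l) / F (1 / l)) (𝓝[>] 0) (𝓝 (u ^ (-a))) := by
        refine h1.congr fun l => ?_
        simp only [Function.comp, mul_one_div]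
      have h3 := ((h2.sub_const (u ^ (-a))).abs).const_mul ((1 + B * u) * Real.exp (-(b₀ * u)))
      simpa using h3
  simpa using hlim

theorem integral_one_sub_mul_exp_mul_rpow {a b : ℝ} (ha0 : 0 < a) (ha1 : a < 1) (hb : 0 < b) :
    ∫ u in Set.Ioi (0 : ℝ), (1 - b * u) * Real.exp (-(b * u)) * u ^ (-a) =
      a * Real.Gamma (1 - a) * b ^ (a - 1) := by
  have hrp : ∀ s : ℝ, -1 < s → IntegrableOn (fun u : ℝ => u ^ s * Real.exp (-(b * u)))
      (Set.Ioi 0) := by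
    intro s hs
    simpa only [Real.rpow_one, neg_mul] using
      integrableOn_rpow_mul_exp_neg_mul_rpow (p := 1) hs one_pos hb
  have e : ∀ u ∈ Set.Ioi (0 : ℝ), (1 - b * u) * Real.exp (-(b * u)) * u ^ (-a) =
      u ^ (-a) * Real.exp (-(b * u)) - b * (u ^ (1 - a) * Real.exp (-(b * u))) := by
    intro u hu
    have hu0 : (0 : ℝ) < u := hu
    rw [show 1 - a = -a + 1 by ring, Real.rpow_add_one hu0.ne']
    ring
  rw [setIntegral_congr_fun measurableSet_Ioi e,
    integral_sub (hrp (-a) (by linarith)) ((hrp (1 - a) (by linarith)).const_mul b),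
    integral_const_mul]
  have h1 := Real.integral_rpow_mul_exp_neg_mul_Ioi (a := 1 - a) (r := b) (by linarith) hb
  have h2 := Real.integral_rpow_mul_exp_neg_mul_Ioi (a := 2 - a) (r := b) (by linarith) hb
  rw [show 1 - a - 1 = -a by ring] at h1
  rw [show 2 - a - 1 = 1 - a by ring, show 2 - a = (1 - a) + 1 by ring,
    Real.Gamma_add_one (by linarith), Real.rpow_add_one (by positivity)] at h2
  rw [h1, h2, one_div, Real.inv_rpow hb.le, ← Real.rpow_neg hb.le, neg_sub]
  field_simp
  ring

/-! ### Laplace transforms near the origin -/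

section Laplace

variable {Ω : Type*} [MeasurableSpace Ω] {P : Measure Ω} [IsProbabilityMeasure P] {W : Ω → ℝ}

theorem integrableOn_affine_mul_exp (c : ℝ) {b : ℝ} (hb : 0 < b) :
    IntegrableOn (fun u : ℝ => (1 + c * u) * Real.exp (-(b * u))) (Set.Ioi 0) := by
  have hrp : ∀ s : ℝ, -1 < s → IntegrableOn (fun u : ℝ => u ^ s * Real.exp (-(b * u)))
      (Set.Ioi 0) := by
    intro s hs
    simpa only [Real.rpow_one, neg_mul] using
      integrableOn_rpow_mul_exp_neg_mul_rpow (p := 1) hs one_pos hb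
  refine IntegrableOn.congr_fun ((hrp 0 (by norm_num)).add ((hrp 1 (by norm_num)).const_mul c))
    (fun u _ => ?_) measurableSet_Ioi
  simp only [Pi.add_apply, Real.rpow_zero, Real.rpow_one]
  ring

theorem integrableOn_affine_mul_exp_mul_rpow (c : ℝ) {a b : ℝ} (ha1 : a < 1) (hb : 0 < b) :
    IntegrableOn (fun u : ℝ => (1 + c * u) * Real.exp (-(b * u)) * u ^ (-a)) (Set.Ioi 0) := by
  have hrp : ∀ s : ℝ, -1 < s → IntegrableOn (fun u : ℝ => u ^ s * Real.exp (-(b * u)))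
      (Set.Ioi 0) := by
    intro s hs
    simpa only [Real.rpow_one, neg_mul] using
      integrableOn_rpow_mul_exp_neg_mul_rpow (p := 1) hs one_pos hb
  refine IntegrableOn.congr_fun ((hrp (-a) (by linarith)).add
    ((hrp (-a + 1) (by linarith)).const_mul c)) (fun u hu => ?_) measurableSet_Ioi
  have hu0 : (0 : ℝ) < u := hu
  simp only [Pi.add_apply, Real.rpow_add_one hu0.ne']
  ring

/-- `w * exp (-(s * w))` is the integral of its derivative in `w`, written over a fixed domain. -/
theorem mul_exp_eq_setIntegral (s : ℝ) {w : ℝ} (hw : 0 ≤ w) :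
    w * Real.exp (-(s * w)) = ∫ x in Set.Ioi (0 : ℝ),
      (Set.Iio w).indicator (fun x => (1 + -s * x) * Real.exp (-(s * x))) x := by
  rw [setIntegral_indicator measurableSet_Iio, Set.Ioi_inter_Iio,
    ← integral_Ioc_eq_integral_Ioo, ← intervalIntegral.integral_of_le hw,
    intervalIntegral.integral_eq_sub_of_hasDerivAt (f := fun x => x * Real.exp (-(s * x)))]
  · simp
  · intro x _
    have h1 : HasDerivAt (fun x : ℝ => -(s * x)) (-(s * 1)) x :=
      ((hasDerivAt_id x).const_mul s).neg
    have h := (hasDerivAt_id x).mul h1.exp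
    convert! h using 1
    simp only [id]
    ring
  · exact Continuous.intervalIntegrable (by fun_prop) _ _

/-- The derivative of the Laplace transform in terms of the tail function. -/
theorem integral_mul_exp_eq (hW : Measurable W) (hnn : ∀ ω, 0 ≤ W ω) {s : ℝ} (hs : 0 < s) :
    ∫ ω, W ω * Real.exp (-(s * W ω)) ∂P =
      ∫ x in Set.Ioi (0 : ℝ), (1 + -s * x) * Real.exp (-(s * x)) * P.real {ω | x < W ω} := by
  simp_rw [fun ω => mul_exp_eq_setIntegral s (hnn ω)]
  have hms : MeasurableSet {q : Ω × ℝ | q.2 < W q.1} :=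
    measurableSet_lt measurable_snd (hW.comp measurable_fst)
  have hfun : (Function.uncurry fun (ω : Ω) (x : ℝ) => (Set.Iio (W ω)).indicator
      (fun x => (1 + -s * x) * Real.exp (-(s * x))) x) =
      {q : Ω × ℝ | q.2 < W q.1}.indicator
        (fun q => (1 + -s * q.2) * Real.exp (-(s * q.2))) := by
    ext ⟨ω, x⟩
    simp only [Function.uncurry, Set.indicator, Set.mem_Iio, Set.mem_ofPred_eq]
  rw [integral_integral_swap]
  · refine setIntegral_congr_fun measurableSet_Ioi fun x _ => ?_
    have : ∀ ω, (Set.Iio (W ω)).indicator (fun x => (1 + -s * x) * Real.exp (-(s * x))) x =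
        {ω | x < W ω}.indicator (fun _ => (1 + -s * x) * Real.exp (-(s * x))) ω := by
      intro ω
      simp only [Set.indicator, Set.mem_Iio, Set.mem_ofPred_eq]
    simp_rw [this]
    rw [integral_indicator_const _ (measurableSet_lt measurable_const hW), smul_eq_mul, mul_comm]
  · rw [hfun]
    exact ((integrableOn_affine_mul_exp (-s) hs).comp_snd P).indicator hms

theorem rescaled_integral_mul_exp_eq (hW : Measurable W) (hnn : ∀ ω, 0 ≤ W ω) {l b : ℝ}
    (hl : 0 < l) (hb : 0 < b) :
    ∫ ω, W ω * Real.exp (-(l * b * W ω)) ∂P =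
      l⁻¹ * ∫ u in Set.Ioi (0 : ℝ), (1 + -b * u) * Real.exp (-(b * u)) *
        P.real {ω | u / l < W ω} := by
  rw [integral_mul_exp_eq hW hnn (mul_pos hl hb)]
  have := integral_comp_mul_left_Ioi (fun u => (1 + -b * u) * Real.exp (-(b * u)) *
        P.real {ω | u / l < W ω}) 0 hl
  rw [mul_zero, smul_eq_mul] at this
  rw [← this]
  refine setIntegral_congr_fun measurableSet_Ioi fun x _ => ?_
  simp only [mul_div_cancel_left₀ _ hl.ne']
  ring_nf

/-- Uniform Tauberian asymptotics of the derivative of the Laplace transform at `0`. -/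
theorem eventually_abs_integral_mul_exp_sub_le {a : ℝ} (ha0 : 0 < a) (ha1 : a < 1)
    (hW : Measurable W) (hnn : ∀ ω, 0 ≤ W ω)
    (hF : IsRegularTail (fun x => P.real {ω | x < W ω}) a) {b₀ B η : ℝ} (hb₀ : 0 < b₀)
    (hη : 0 < η) :
    ∀ᶠ l in 𝓝[>] (0 : ℝ), ∀ b ∈ Set.Icc b₀ B,
      |(∫ ω, W ω * Real.exp (-(l * b * W ω)) ∂P) / (l⁻¹ * P.real {ω | 1 / l < W ω}) -
        a * Real.Gamma (1 - a) * b ^ (a - 1)| ≤ η := by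
  rcases lt_or_ge B b₀ with hB | hB
  · refine Eventually.of_forall fun l b hb => absurd (hb.1.trans hb.2) (not_le.2 hB)
  have hB0 : 0 ≤ B := hb₀.le.trans hB
  set F : ℝ → ℝ := fun x => P.real {ω | x < W ω} with hFdef
  have hlim := hF.tendsto_integral_abs_sub ha0 ha1 B hb₀ hB0
  filter_upwards [hlim.eventually (gt_mem_nhds hη), self_mem_nhdsWithin] with l hl hl0 b hb
  have hl0' : (0 : ℝ) < l := hl0
  have hbpos : 0 < b := hb₀.trans_le hb.1
  have hF1 : 0 < F (1 / l) := hF.pos _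
  have hmF : Measurable fun u : ℝ => F (u / l) :=
    hF.anti.measurable.comp (measurable_id.div_const l)
  rw [rescaled_integral_mul_exp_eq hW hnn hl0' hbpos, ← integral_one_sub_mul_exp_mul_rpow ha0 ha1
    hbpos, mul_div_mul_left _ _ (inv_ne_zero hl0'.ne'), ← integral_div]
  have hi : ∀ c d : ℝ, 0 < d → IntegrableOn
      (fun u => (1 + c * u) * Real.exp (-(d * u)) * (F (u / l) / F (1 / l))) (Set.Ioi 0) := by
    intro c d hd
    refine (integrableOn_affine_mul_exp c hd).mul_bdd (c := 1 / F (1 / l))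
      (hmF.div_const _).aestronglyMeasurable (Eventually.of_forall fun u => ?_)
    rw [Real.norm_eq_abs, abs_of_nonneg (div_nonneg (hF.pos _).le hF1.le)]
    exact div_le_div_of_nonneg_right (hF.le_one _) hF1.le
  have e1 : ∀ u, (1 + -b * u) * Real.exp (-(b * u)) * P.real {ω | u / l < W ω} /
      P.real {ω | 1 / l < W ω} =
      (1 + -b * u) * Real.exp (-(b * u)) * (F (u / l) / F (1 / l)) := fun u => by
    simp only [hFdef]; ring
  have e2 : ∀ u : ℝ, (1 - b * u) * Real.exp (-(b * u)) * u ^ (-a) =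
      (1 + -b * u) * Real.exp (-(b * u)) * u ^ (-a) := fun u => by ring
  simp_rw [e1, e2]
  rw [← integral_sub (hi _ b hbpos) (integrableOn_affine_mul_exp_mul_rpow _ ha1 hbpos)]
  have hub : IntegrableOn (fun u => (1 + B * u) * Real.exp (-(b₀ * u)) *
      |F (u / l) / F (1 / l) - u ^ (-a)|) (Set.Ioi 0) := by
    have h1 := ((hi B b₀ hb₀).sub (integrableOn_affine_mul_exp_mul_rpow B ha1 hb₀)).abs
    refine IntegrableOn.congr_fun h1 (fun u hu => ?_) measurableSet_Ioi
    have hu0 : (0 : ℝ) < u := hu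
    have hw : 0 ≤ (1 + B * u) * Real.exp (-(b₀ * u)) := by positivity
    simp only [Pi.sub_apply]
    rw [← mul_sub, abs_mul, abs_of_nonneg hw]
  refine le_trans ?_ hl.le
  rw [← Real.norm_eq_abs]
  refine norm_integral_le_of_norm_le hub ?_
  refine (ae_restrict_iff' measurableSet_Ioi).2 (Eventually.of_forall fun u hu => ?_)
  have hu0 : (0 : ℝ) < u := hu
  rw [← mul_sub, Real.norm_eq_abs, abs_mul, abs_mul, Real.abs_exp]
  have h1 : |1 + -b * u| ≤ 1 + B * u := by
    have := mul_le_mul_of_nonneg_right hb.2 hu0.le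
    have h2 := mul_pos hbpos hu0
    rw [abs_le]; constructor <;> linarith
  have h2 : Real.exp (-(b * u)) ≤ Real.exp (-(b₀ * u)) := by
    have := mul_le_mul_of_nonneg_right hb.1 hu0.le
    exact Real.exp_le_exp.2 (by linarith)
  gcongr

theorem integrable_exp_neg_mul (hW : Measurable W) (hnn : ∀ ω, 0 ≤ W ω) {s : ℝ} (hs : 0 ≤ s) :
    Integrable (fun ω => Real.exp (-(s * W ω))) P := by
  refine Integrable.of_bound (by fun_prop) 1 (Eventually.of_forall fun ω => ?_)
  rw [Real.norm_eq_abs, Real.abs_exp, Real.exp_le_one_iff]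
  linarith [mul_nonneg hs (hnn ω)]

/-- Uniform Tauberian asymptotics of the logarithmic derivative of the Laplace transform. -/
theorem eventually_abs_logDeriv_laplace_sub_le {a : ℝ} (ha0 : 0 < a) (ha1 : a < 1)
    (hW : Measurable W) (hnn : ∀ ω, 0 ≤ W ω)
    (hF : IsRegularTail (fun x => P.real {ω | x < W ω}) a) {b₀ B η : ℝ} (hb₀ : 0 < b₀)
    (hη : 0 < η) :
    ∀ᶠ l in 𝓝[>] (0 : ℝ), ∀ b ∈ Set.Icc b₀ B,
      |(∫ ω, W ω * Real.exp (-(l * b * W ω)) ∂P) / (∫ ω, Real.exp (-(l * b * W ω)) ∂P) /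
        (l⁻¹ * P.real {ω | 1 / l < W ω}) - a * Real.Gamma (1 - a) * b ^ (a - 1)| ≤ η := by
  rcases lt_or_ge B b₀ with hB | hB
  · refine Eventually.of_forall fun l b hb => absurd (hb.1.trans hb.2) (not_le.2 hB)
  have hB0 : 0 ≤ B := hb₀.le.trans hB
  have hκ : 0 < a * Real.Gamma (1 - a) := mul_pos ha0 (Real.Gamma_pos_of_pos (by linarith))
  set C := a * Real.Gamma (1 - a) * b₀ ^ (a - 1) + 1 with hC
  have hC1 : 0 < C := by positivity
  have hη' : 0 < min (η / 2) 1 := by positivity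
  have hφ : Tendsto (fun l : ℝ => 1 / (∫ ω, Real.exp (-(l * B * W ω)) ∂P)) (𝓝[>] 0) (𝓝 1) := by
    have : Tendsto (fun l : ℝ => ∫ ω, Real.exp (-(l * B * W ω)) ∂P) (𝓝[>] 0)
        (𝓝 (∫ _, (1 : ℝ) ∂P)) := by
      refine tendsto_integral_filter_of_dominated_convergence (fun _ => 1)
        (Eventually.of_forall fun l => by fun_prop) ?_ (integrable_const _) ?_
      · filter_upwards [self_mem_nhdsWithin] with l hl
        refine Eventually.of_forall fun ω => ?_
        rw [Real.norm_eq_abs, Real.abs_exp, Real.exp_le_one_iff]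
        linarith [mul_nonneg (mul_nonneg (le_of_lt (Set.mem_Ioi.1 hl)) hB0) (hnn ω)]
      · refine Eventually.of_forall fun ω => ?_
        have h : Tendsto (fun l : ℝ => Real.exp (-(l * B * W ω))) (𝓝 0)
            (𝓝 (Real.exp (-(0 * B * W ω)))) := Continuous.tendsto (by fun_prop) 0
        simpa using h.mono_left nhdsWithin_le_nhds
    simpa using this.inv₀ (by simp)
  have hφ' := hφ.eventually (gt_mem_nhds (show (1 : ℝ) < 1 + η / (2 * C) by
    linarith [show 0 < η / (2 * C) by positivity]))
  filter_upwards [eventually_abs_integral_mul_exp_sub_le ha0 ha1 hW hnn hF (B := B) hb₀ hη', hφ',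
    self_mem_nhdsWithin] with l h1 h2 hl b hb
  have hl0 : (0 : ℝ) < l := hl
  have hbpos : 0 < b := hb₀.trans_le hb.1
  have h1b := h1 b hb
  set g := (∫ ω, W ω * Real.exp (-(l * b * W ω)) ∂P) / (l⁻¹ * P.real {ω | 1 / l < W ω}) with hg
  have hpw : b ^ (a - 1) ≤ b₀ ^ (a - 1) :=
    Real.rpow_le_rpow_of_nonpos hb₀ hb.1 (by linarith)
  have hpw0 : 0 < b ^ (a - 1) := Real.rpow_pos_of_pos hbpos _
  have hgC : |g| ≤ C := by
    have h3 := (abs_le.1 (h1b.trans (min_le_right _ _)))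
    have h4 := mul_le_mul_of_nonneg_left hpw hκ.le
    have h5 := mul_pos hκ hpw0
    rw [abs_le]
    constructor <;> linarith
  have hi1 := integrable_exp_neg_mul (P := P) hW hnn (mul_nonneg hl0.le hbpos.le)
  have hi2 := integrable_exp_neg_mul (P := P) hW hnn (mul_nonneg hl0.le hB0)
  have hp1 : 0 < ∫ ω, Real.exp (-(l * b * W ω)) ∂P := integral_exp_pos hi1
  have hp2 : 0 < ∫ ω, Real.exp (-(l * B * W ω)) ∂P := integral_exp_pos hi2
  have hmono : ∫ ω, Real.exp (-(l * B * W ω)) ∂P ≤ ∫ ω, Real.exp (-(l * b * W ω)) ∂P := by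
    refine integral_mono hi2 hi1 fun ω => Real.exp_le_exp.2 ?_
    have := mul_le_mul_of_nonneg_right (mul_le_mul_of_nonneg_left hb.2 hl0.le) (hnn ω)
    linarith
  have hle1 : ∫ ω, Real.exp (-(l * b * W ω)) ∂P ≤ 1 := by
    have : ∫ ω, Real.exp (-(l * b * W ω)) ∂P ≤ ∫ _, (1 : ℝ) ∂P := by
      refine integral_mono hi1 (integrable_const _) fun ω => ?_
      have := mul_nonneg (mul_nonneg hl0.le hbpos.le) (hnn ω)
      exact Real.exp_le_one_iff.2 (by linarith)
    simpa using this
  set f := ∫ ω, Real.exp (-(l * b * W ω)) ∂P with hf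
  have hfi : 1 / f ≤ 1 + η / (2 * C) := (one_div_le_one_div_of_le hp2 hmono).trans h2.le
  have hfi1 : 1 ≤ 1 / f := by rw [le_div_iff₀ hp1]; linarith
  have e : (∫ ω, W ω * Real.exp (-(l * b * W ω)) ∂P) / f / (l⁻¹ * P.real {ω | 1 / l < W ω}) =
      g * (1 / f - 1) + g := by rw [hg]; ring
  rw [e, add_sub_assoc]
  calc _ ≤ |g * (1 / f - 1)| + |g - a * Real.Gamma (1 - a) * b ^ (a - 1)| := abs_add_le _ _
    _ ≤ C * (η / (2 * C)) + η / 2 := by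
        refine add_le_add ?_ (h1b.trans (min_le_left _ _))
        rw [abs_mul, abs_of_nonneg (by linarith : 0 ≤ 1 / f - 1)]
        exact mul_le_mul hgC (by linarith) (by linarith) hC1.le
    _ = η := by field_simp; ring

end Laplace

/-! ### Ratios of weighted sums of heavy-tailed variables -/

/-- An application of `1 / T = ∫ exp (-l T) dl`: a bound on the Laplace-weighted mean of `D` relative
to that of `T`, for `l ≤ δ`, controls the mean of `D / T`; the part of the integral over `l > δ`
accounts for the second term of the bound. -/
theorem abs_integral_div_le {Ω : Type*} [MeasurableSpace Ω] {P : Measure Ω}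
    [IsProbabilityMeasure P] {D T : Ω → ℝ} (hD : Measurable D) (hT : Measurable T)
    (hT0 : ∀ ω, 0 ≤ T ω) {C δ ε : ℝ} (hδ : 0 < δ) (hε : 0 ≤ ε) (hDT : ∀ ω, |D ω| ≤ C * T ω)
    (h : ∀ l ∈ Set.Ioc 0 δ, |∫ ω, D ω * Real.exp (-(l * T ω)) ∂P| ≤
      ε * ∫ ω, T ω * Real.exp (-(l * T ω)) ∂P) (hC : 0 ≤ C) :
    |∫ ω, D ω / T ω ∂P| ≤ ε + C * ∫ ω, Real.exp (-(δ * T ω)) ∂P := by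
  have hint : ∀ t d : ℝ, ∫ l in Set.Ioc 0 δ, d * t * Real.exp (-(l * t)) =
      d * (1 - Real.exp (-(δ * t))) := by
    intro t d
    rw [← intervalIntegral.integral_of_le hδ.le,
      intervalIntegral.integral_eq_sub_of_hasDerivAt (f := fun l => -(d * Real.exp (-(l * t))))]
    · simp; ring
    · intro l _
      have h1 : HasDerivAt (fun l : ℝ => -(l * t)) (-(1 * t)) l :=
        ((hasDerivAt_id l).mul_const t).neg
      convert! (h1.exp.const_mul d).neg using 1
      ring
    · exact Continuous.intervalIntegrable (by fun_prop) _ _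
  have hquot : ∀ ω, |D ω / T ω| ≤ C := by
    intro ω
    rcases (hT0 ω).eq_or_lt with h0 | h0
    · rw [← h0, div_zero, abs_zero]; exact hC
    · rw [abs_div, abs_of_pos h0, div_le_iff₀ h0]; exact hDT ω
  have hDT' : ∀ ω, D ω / T ω * T ω = D ω := by
    intro ω
    rcases (hT0 ω).eq_or_lt with h0 | h0
    · have := hDT ω
      rw [← h0, mul_zero] at this
      rw [← h0, mul_zero, abs_nonpos_iff.1 this]
    · rw [div_mul_cancel₀ _ h0.ne']
  have hexp : ∀ l ω, 0 ≤ l → |Real.exp (-(l * T ω))| ≤ 1 := by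
    intro l ω hl
    rw [Real.abs_exp, Real.exp_le_one_iff]
    linarith [mul_nonneg hl (hT0 ω)]
  have hIT : Integrable (fun q : Ω × ℝ => T q.1 * Real.exp (-(q.2 * T q.1)))
      (P.prod (volume.restrict (Set.Ioc 0 δ))) := by
    have hm : Measurable fun q : Ω × ℝ => T q.1 * Real.exp (-(q.2 * T q.1)) := by fun_prop
    rw [integrable_prod_iff hm.aestronglyMeasurable]
    refine ⟨Eventually.of_forall fun ω => ?_, ?_⟩
    · exact (Continuous.integrableOn_Ioc (by fun_prop))
    · have : ∀ ω, ∫ l in Set.Ioc 0 δ, ‖T ω * Real.exp (-(l * T ω))‖ =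
          1 - Real.exp (-(δ * T ω)) := by
        intro ω
        have := hint (T ω) 1
        rw [one_mul, one_mul] at this
        rw [← this]
        congr 1; ext l
        rw [Real.norm_eq_abs, abs_of_nonneg (mul_nonneg (hT0 ω) (Real.exp_pos _).le)]
      simp_rw [this]
      exact (integrable_const _).sub (Integrable.of_bound (by fun_prop) 1
        (Eventually.of_forall fun ω => hexp δ ω hδ.le))
  have hID : Integrable (fun q : Ω × ℝ => D q.1 * Real.exp (-(q.2 * T q.1)))
      (P.prod (volume.restrict (Set.Ioc 0 δ))) := by
    have hm : Measurable fun q : Ω × ℝ => D q.1 * Real.exp (-(q.2 * T q.1)) := by fun_prop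
    refine (hIT.const_mul C).mono' hm.aestronglyMeasurable (Eventually.of_forall fun q => ?_)
    rw [norm_mul, Real.norm_eq_abs, Real.norm_eq_abs, Real.abs_exp, ← mul_assoc]
    exact mul_le_mul_of_nonneg_right (hDT _) (Real.exp_pos _).le
  have hdec : ∀ ω, D ω / T ω = (∫ l in Set.Ioc 0 δ, D ω * Real.exp (-(l * T ω))) +
      D ω / T ω * Real.exp (-(δ * T ω)) := by
    intro ω
    have := hint (T ω) (D ω / T ω)
    rw [hDT'] at this
    rw [this]; ring
  have hm2 : Integrable (fun ω => D ω / T ω * Real.exp (-(δ * T ω))) P := by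
    refine Integrable.of_bound (by fun_prop) C (Eventually.of_forall fun ω => ?_)
    rw [norm_mul]
    exact (mul_le_mul (hquot ω) (hexp δ ω hδ.le) (abs_nonneg _) hC).trans (by rw [mul_one])
  have hIexp : Integrable (fun ω => Real.exp (-(δ * T ω))) P :=
    Integrable.of_bound (by fun_prop) 1 (Eventually.of_forall fun ω => hexp δ ω hδ.le)
  rw [integral_congr_ae (Eventually.of_forall hdec), integral_add hID.integral_prod_left hm2]
  refine (abs_add_le _ _).trans (add_le_add ?_ ?_)
  · rw [integral_integral_swap hID]
    have h1 : |∫ l in Set.Ioc 0 δ, ∫ ω, D ω * Real.exp (-(l * T ω)) ∂P| ≤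
        ∫ l in Set.Ioc 0 δ, ε * ∫ ω, T ω * Real.exp (-(l * T ω)) ∂P := by
      rw [← Real.norm_eq_abs]
      refine norm_integral_le_of_norm_le (hIT.integral_prod_right.const_mul ε) ?_
      exact (ae_restrict_iff' measurableSet_Ioc).2 (Eventually.of_forall fun l hl => h l hl)
    refine h1.trans ?_
    rw [integral_const_mul, ← integral_integral_swap hIT]
    have h2 : ∀ ω, ∫ l in Set.Ioc 0 δ, T ω * Real.exp (-(l * T ω)) =
        1 - Real.exp (-(δ * T ω)) := by
      intro ω
      simpa using hint (T ω) 1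
    simp_rw [h2]
    rw [integral_sub (integrable_const _) hIexp]
    have h3 : 0 ≤ ∫ ω, Real.exp (-(δ * T ω)) ∂P := integral_nonneg fun _ => (Real.exp_pos _).le
    simp only [integral_const, probReal_univ, smul_eq_mul, mul_one]
    nlinarith
  · rw [← integral_const_mul, ← Real.norm_eq_abs]
    refine norm_integral_le_of_norm_le (hIexp.const_mul C) (Eventually.of_forall fun ω => ?_)
    rw [norm_mul, Real.norm_eq_abs, Real.norm_eq_abs, Real.abs_exp]
    exact mul_le_mul_of_nonneg_right (hquot ω) (Real.exp_pos _).le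

/-- Minus the logarithmic derivative of the Laplace transform of `W`. -/
def laplaceRate {Ω : Type*} [MeasurableSpace Ω] (P : Measure Ω) (W : Ω → ℝ) (s : ℝ) : ℝ :=
  (∫ ω, W ω * Real.exp (-(s * W ω)) ∂P) / (∫ ω, Real.exp (-(s * W ω)) ∂P)

section IID

variable {Ω : Type*} [MeasurableSpace Ω] {P : Measure Ω} [IsProbabilityMeasure P]
  {W : ℕ → Ω → ℝ}

omit [IsProbabilityMeasure P] in
theorem integral_exp_sum (hW : ∀ j, Measurable (W j))
    (hind : iIndepFun W P) (hid : ∀ j, IdentDistrib (W j) (W 0) P P) {n : ℕ} (s : Fin n → ℝ) :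
    ∫ ω, Real.exp (-(∑ i, s i * W i ω)) ∂P = ∏ i, ∫ ω, Real.exp (-(s i * W 0 ω)) ∂P := by
  have hind' : iIndepFun (fun i : Fin n => W i) P :=
    hind.precomp (g := fun i : Fin n => (i : ℕ)) Fin.val_injective
  have h := hind'.integral_fun_prod_comp (f := fun i x => Real.exp (-(s i * x)))
    (fun i => (hW i).aemeasurable) (fun i => by fun_prop)
  simp_rw [← Real.exp_sum, Finset.sum_neg_distrib] at h
  rw [h]
  refine Finset.prod_congr rfl fun i _ => ?_
  exact ((hid i).comp (u := fun x => Real.exp (-(s i * x))) (by fun_prop)).integral_eq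

/-- Singling out one factor of the product of independent exponentials. -/
theorem integral_mul_exp_sum (hW : ∀ j, Measurable (W j)) (hnn : ∀ j ω, 0 ≤ W j ω)
    (hind : iIndepFun W P) (hid : ∀ j, IdentDistrib (W j) (W 0) P P) {n : ℕ} {s : Fin n → ℝ}
    (hs : ∀ i, 0 ≤ s i) (j : Fin n) :
    ∫ ω, W j ω * Real.exp (-(∑ i, s i * W i ω)) ∂P =
      (∏ i, ∫ ω, Real.exp (-(s i * W 0 ω)) ∂P) * laplaceRate P (W 0) (s j) := by
  have hind' : iIndepFun (fun i : Fin n => W i) P :=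
    hind.precomp (g := fun i : Fin n => (i : ℕ)) Fin.val_injective
  have h := hind'.integral_fun_prod_comp
    (f := fun i x => (if i = j then x else 1) * Real.exp (-(s i * x)))
    (fun i => (hW i).aemeasurable) (fun i => by
      split_ifs
      · exact Continuous.aestronglyMeasurable (by fun_prop)
      · exact Continuous.aestronglyMeasurable (by fun_prop))
  simp_rw [Finset.prod_mul_distrib, ← Real.exp_sum, Finset.sum_neg_distrib] at h
  simp only [Finset.prod_ite_eq', Finset.mem_univ, if_true] at h
  rw [h]
  have e : ∀ i, ∫ ω, (if i = j then W i ω else 1) * Real.exp (-(s i * W i ω)) ∂P =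
      (∫ ω, Real.exp (-(s i * W 0 ω)) ∂P) *
        (if i = j then laplaceRate P (W 0) (s i) else 1) := by
    intro i
    have hpos := integral_exp_pos (integrable_exp_neg_mul (P := P) (hW 0) (hnn 0) (hs i))
    split_ifs with hij
    · rw [laplaceRate, mul_div_cancel₀ _ hpos.ne']
      exact ((hid i).comp (u := fun x => x * Real.exp (-(s i * x))) (by fun_prop)).integral_eq
    · simp only [one_mul, mul_one]
      exact ((hid i).comp (u := fun x => Real.exp (-(s i * x))) (by fun_prop)).integral_eq
  simp_rw [e, Finset.prod_mul_distrib, Finset.prod_ite_eq', Finset.mem_univ, if_true]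

theorem integrable_mul_exp_sum (hW : ∀ j, Measurable (W j)) (hnn : ∀ j ω, 0 ≤ W j ω)
    {n : ℕ} {s : Fin n → ℝ} (hs : ∀ i, 0 < s i) (j : Fin n) :
    Integrable (fun ω => W j ω * Real.exp (-(∑ i, s i * W i ω))) P := by
  refine Integrable.of_bound (by fun_prop) (1 / s j) (Eventually.of_forall fun ω => ?_)
  have hle : s j * W j ω ≤ ∑ i, s i * W i ω :=
    Finset.single_le_sum (f := fun i : Fin n => s i * W i ω)
      (fun i _ => mul_nonneg (hs i).le (hnn i ω)) (Finset.mem_univ j)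
  rw [Real.norm_eq_abs, abs_of_nonneg (mul_nonneg (hnn _ _) (Real.exp_pos _).le),
    le_div_iff₀ (hs j), Real.exp_neg, mul_right_comm, ← div_eq_mul_inv,
    div_le_one (Real.exp_pos _)]
  have := Real.add_one_le_exp (∑ i, s i * W i ω)
  linarith [mul_comm (W j ω) (s j)]

theorem integral_sum_mul_exp_sum (hW : ∀ j, Measurable (W j)) (hnn : ∀ j ω, 0 ≤ W j ω)
    (hind : iIndepFun W P) (hid : ∀ j, IdentDistrib (W j) (W 0) P P) {n : ℕ} {s : Fin n → ℝ}
    (hs : ∀ i, 0 < s i) (c : Fin n → ℝ) :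
    ∫ ω, (∑ j, c j * W j ω) * Real.exp (-(∑ i, s i * W i ω)) ∂P =
      (∏ i, ∫ ω, Real.exp (-(s i * W 0 ω)) ∂P) * ∑ j, c j * laplaceRate P (W 0) (s j) := by
  simp_rw [Finset.sum_mul, mul_assoc]
  rw [integral_finsetSum _ fun j _ => (integrable_mul_exp_sum hW hnn hs j).const_mul (c j),
    Finset.mul_sum]
  refine Finset.sum_congr rfl fun j _ => ?_
  rw [integral_const_mul, integral_mul_exp_sum hW hnn hind hid (fun i => (hs i).le)]
  ring

theorem integral_exp_lt_one {W : Ω → ℝ} (hW : Measurable W) (hnn : ∀ ω, 0 ≤ W ω)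
    (hpos : 0 < P.real {ω | 0 < W ω}) {s : ℝ} (hs : 0 < s) :
    ∫ ω, Real.exp (-(s * W ω)) ∂P < 1 := by
  have hi := integrable_exp_neg_mul (P := P) hW hnn hs.le
  have h1 : 0 < ∫ ω, (1 - Real.exp (-(s * W ω))) ∂P := by
    rw [integral_pos_iff_support_of_nonneg (f := fun ω => 1 - Real.exp (-(s * W ω))) _
      ((integrable_const _).sub hi)]
    · refine lt_of_lt_of_le (ENNReal.toReal_pos_iff.1 hpos).1 (measure_mono fun ω hω => ?_)
      have : Real.exp (-(s * W ω)) < 1 :=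
        Real.exp_lt_one_iff.2 (by linarith [mul_pos hs (show 0 < W ω from hω)])
      exact (sub_pos.2 this).ne'
    · intro ω
      have : Real.exp (-(s * W ω)) ≤ 1 :=
        Real.exp_le_one_iff.2 (by linarith [mul_nonneg hs.le (hnn ω)])
      exact sub_nonneg.2 this
  rw [integral_sub (integrable_const _) hi] at h1
  simp at h1
  exact h1

theorem tendsto_integral_exp_sum (hW : ∀ j, Measurable (W j)) (hnn : ∀ j ω, 0 ≤ W j ω)
    (hind : iIndepFun W P) (hid : ∀ j, IdentDistrib (W j) (W 0) P P)
    (hpos : 0 < P.real {ω | 0 < W 0 ω}) {s : ℝ} (hs : 0 < s) :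
    Tendsto (fun n : ℕ => ∫ ω, Real.exp (-(s * ∑ i : Fin n, W i ω)) ∂P) atTop (𝓝 0) := by
  have h : ∀ n : ℕ, ∫ ω, Real.exp (-(s * ∑ i : Fin n, W i ω)) ∂P =
      (∫ ω, Real.exp (-(s * W 0 ω)) ∂P) ^ n := by
    intro n
    simp_rw [Finset.mul_sum]
    rw [integral_exp_sum hW hind hid (fun _ : Fin n => s)]
    simp
  simp_rw [h]
  exact tendsto_pow_atTop_nhds_zero_of_lt_one (integral_nonneg fun _ => (Real.exp_pos _).le)
    (integral_exp_lt_one (hW 0) (hnn 0) hpos hs)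

theorem tendsto_measure_sum_eq_zero (hW : ∀ j, Measurable (W j)) (hnn : ∀ j ω, 0 ≤ W j ω)
    (hind : iIndepFun W P) (hid : ∀ j, IdentDistrib (W j) (W 0) P P)
    (hpos : 0 < P.real {ω | 0 < W 0 ω}) :
    Tendsto (fun n : ℕ => P.real {ω | ∑ i : Fin n, W i ω = 0}) atTop (𝓝 0) := by
  refine squeeze_zero (fun _ => measureReal_nonneg) (fun n => ?_)
    (tendsto_integral_exp_sum hW hnn hind hid hpos one_pos)
  have hm : MeasurableSet {ω | ∑ i : Fin n, W i ω = 0} :=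
    measurableSet_eq_fun (Finset.measurable_sum _ fun i _ => hW i) measurable_const
  rw [← integral_indicator_one hm]
  refine integral_mono ((integrable_const 1).indicator hm)
    (integrable_exp_neg_mul (W := fun ω => ∑ i : Fin n, W i ω)
      (Finset.measurable_sum _ fun i _ => hW i)
      (fun ω => Finset.sum_nonneg fun i _ => hnn i ω) one_pos.le) fun ω => ?_
  by_cases h : ∑ i : Fin n, W i ω = 0
  · rw [Set.indicator_of_mem (by exact h)]; simp [h]
  · rw [Set.indicator_of_notMem (by exact h)]; exact (Real.exp_pos _).le

/-- If the rates `r` are, up to a common factor `k` and a small error, the values of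
`κ b ^ (a - 1)`, then the weighted sum with weights `1 - c b` is negligible. -/
theorem abs_sum_rate_le {n : ℕ} {b r : Fin n → ℝ} {a b₀ B c κ k η ε q : ℝ} (hb₀ : 0 < b₀)
    (hb : ∀ i, b i ∈ Set.Icc b₀ B) (hc : 0 ≤ c) (hκ : 0 ≤ κ) (hk : 0 < k) (hε : 0 ≤ ε)
    (hr : ∀ i, |r i / k - κ * b i ^ (a - 1)| ≤ η)
    (hpq : |(n : ℝ)⁻¹ * ∑ i, b i ^ (a - 1) - c * ((n : ℝ)⁻¹ * ∑ i, b i ^ a)| ≤ η)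
    (hq : q ≤ (n : ℝ)⁻¹ * ∑ i, b i ^ a)
    (hη : η * (κ + 1 + c * B) ≤ ε * (κ * q - B * η)) (hn : 0 < n) :
    |∑ i, (1 - c * b i) * r i| ≤ ε * ∑ i, b i * r i := by
  have hn' : (0 : ℝ) < n := by exact_mod_cast hn
  set e : Fin n → ℝ := fun i => r i / k - κ * b i ^ (a - 1) with he
  have hre : ∀ i, r i = k * (κ * b i ^ (a - 1) + e i) := by
    intro i; simp only [he]; field_simp; ring
  have hbb : ∀ i, b i * b i ^ (a - 1) = b i ^ a := by
    intro i
    have := hb₀.trans_le (hb i).1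
    rw [mul_comm, ← Real.rpow_add_one this.ne', sub_add_cancel]
  have hη0 : 0 ≤ η := (abs_nonneg _).trans hpq
  have e1 : ∑ i, (1 - c * b i) * r i = k * (n * (κ * ((n : ℝ)⁻¹ * ∑ i, b i ^ (a - 1) -
      c * ((n : ℝ)⁻¹ * ∑ i, b i ^ a))) + ∑ i, (1 - c * b i) * e i) := by
    have : ∀ i, (1 - c * b i) * r i = k * (κ * (b i ^ (a - 1) - c * b i ^ a) +
        (1 - c * b i) * e i) := by
      intro i; rw [hre, ← hbb]; ring
    simp_rw [this]
    rw [← Finset.mul_sum, Finset.sum_add_distrib, ← Finset.mul_sum, Finset.sum_sub_distrib,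
      ← Finset.mul_sum]
    field_simp
  have e2 : ∑ i, b i * r i = k * (n * (κ * ((n : ℝ)⁻¹ * ∑ i, b i ^ a)) + ∑ i, b i * e i) := by
    have : ∀ i, b i * r i = k * (κ * b i ^ a + b i * e i) := by
      intro i; rw [hre, ← hbb]; ring
    simp_rw [this]
    rw [← Finset.mul_sum, Finset.sum_add_distrib, ← Finset.mul_sum]
    field_simp
  have b1 : |∑ i, (1 - c * b i) * e i| ≤ n * ((1 + c * B) * η) := by
    refine (Finset.abs_sum_le_sum_abs _ _).trans ?_
    have : ∀ i ∈ Finset.univ, |(1 - c * b i) * e i| ≤ (1 + c * B) * η := by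
      intro i _
      rw [abs_mul]
      have h1 := hb i
      have h2 := mul_le_mul_of_nonneg_left h1.2 hc
      have h3 := mul_nonneg hc (hb₀.le.trans h1.1)
      refine mul_le_mul ?_ (hr i) (abs_nonneg _) (by linarith)
      rw [abs_le]; constructor <;> linarith
    refine (Finset.sum_le_card_nsmul _ _ _ this).trans ?_
    simp
  have b2 : |∑ i, b i * e i| ≤ n * (B * η) := by
    refine (Finset.abs_sum_le_sum_abs _ _).trans ?_
    have : ∀ i ∈ Finset.univ, |b i * e i| ≤ B * η := by
      intro i _
      have h1 := hb i
      rw [abs_mul, abs_of_pos (hb₀.trans_le h1.1)]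
      exact mul_le_mul h1.2 (hr i) (abs_nonneg _) (hb₀.le.trans (h1.1.trans h1.2))
    refine (Finset.sum_le_card_nsmul _ _ _ this).trans ?_
    simp
  rw [e1, e2, abs_mul, abs_of_pos hk, mul_left_comm ε]
  refine mul_le_mul_of_nonneg_left ?_ hk.le
  have u1 : |(n : ℝ) * (κ * ((n : ℝ)⁻¹ * ∑ i, b i ^ (a - 1) -
      c * ((n : ℝ)⁻¹ * ∑ i, b i ^ a))) + ∑ i, (1 - c * b i) * e i| ≤
      n * (κ * η) + n * ((1 + c * B) * η) := by
    refine (abs_add_le _ _).trans (add_le_add ?_ b1)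
    rw [abs_mul, abs_mul, abs_of_pos hn', abs_of_nonneg hκ]
    gcongr
  have u2 : (n : ℝ) * (κ * q) - n * (B * η) ≤
      n * (κ * ((n : ℝ)⁻¹ * ∑ i, b i ^ a)) + ∑ i, b i * e i := by
    have h1 := (abs_le.1 b2).1
    have h2 : (n : ℝ) * (κ * q) ≤ n * (κ * ((n : ℝ)⁻¹ * ∑ i, b i ^ a)) := by gcongr
    linarith
  refine u1.trans (le_trans ?_ (mul_le_mul_of_nonneg_left u2 hε))
  have := mul_le_mul_of_nonneg_left hη hn'.le
  linarith

theorem abs_sum_one_sub_mul_le {n : ℕ} {b w : Fin n → ℝ} {b₀ c : ℝ} (hb₀ : 0 < b₀)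
    (hb : ∀ i, b₀ ≤ b i) (hc : 0 ≤ c) (hw : ∀ i, 0 ≤ w i) :
    |∑ i, (1 - c * b i) * w i| ≤ (1 / b₀ + c) * ∑ i, b i * w i := by
  refine (Finset.abs_sum_le_sum_abs _ _).trans ?_
  rw [Finset.mul_sum]
  refine Finset.sum_le_sum fun i _ => ?_
  rw [abs_mul, abs_of_nonneg (hw i), ← mul_assoc]
  refine mul_le_mul_of_nonneg_right ?_ (hw i)
  have h1 : 1 ≤ 1 / b₀ * b i := by
    rw [one_div_mul_eq_div, le_div_iff₀ hb₀, one_mul]; exact hb i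
  have h2 := mul_nonneg hc (hb₀.le.trans (hb i))
  rw [abs_le]
  constructor <;> linarith

/-- With `c = lim ∑ b ^ (a - 1) / ∑ b ^ a`, the difference of the two sums `∑ W` and
`c ∑ b W` is on average negligible relative to the second one. -/
theorem tendsto_integral_sum_one_sub_mul_div_sum {a : ℝ} (ha0 : 0 < a) (ha1 : a < 1)
    (hW : ∀ j, Measurable (W j)) (hnn : ∀ j ω, 0 ≤ W j ω)
    (hind : iIndepFun W P) (hid : ∀ j, IdentDistrib (W j) (W 0) P P)
    (hF : IsRegularTail (fun x => P.real {ω | x < W 0 ω}) a)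
    (b : (n : ℕ) → Fin n → ℝ) {b₀ B p q : ℝ} (hb₀ : 0 < b₀)
    (hb : ∀ᶠ n in atTop, ∀ i, b n i ∈ Set.Icc b₀ B)
    (hp : Tendsto (fun n : ℕ => (n : ℝ)⁻¹ * ∑ i, b n i ^ (a - 1)) atTop (𝓝 p))
    (hq : Tendsto (fun n : ℕ => (n : ℝ)⁻¹ * ∑ i, b n i ^ a) atTop (𝓝 q)) (hp0 : 0 ≤ p)
    (hq0 : 0 < q) :
    Tendsto (fun n : ℕ => ∫ ω, (∑ i : Fin n, (1 - p / q * b n i) * W i ω) /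
      (∑ i : Fin n, b n i * W i ω) ∂P) atTop (𝓝 0) := by
  have hpos : 0 < P.real {ω | 0 < W 0 ω} := hF.pos 0
  set c := p / q with hc
  have hc0 : 0 ≤ c := div_nonneg hp0 hq0.le
  have hκ : 0 < a * Real.Gamma (1 - a) := mul_pos ha0 (Real.Gamma_pos_of_pos (by linarith))
  set κ := a * Real.Gamma (1 - a) with hκdef
  have hB : b₀ ≤ B := by
    obtain ⟨n, hn, hn1⟩ := (hb.and (eventually_ge_atTop 1)).exists
    exact (hn ⟨0, hn1⟩).1.trans (hn ⟨0, hn1⟩).2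
  have hB0 : 0 < B := hb₀.trans_le hB
  rw [Metric.tendsto_nhds]
  intro ε hε
  have hε2 : 0 < ε / 2 := by positivity
  -- the value of `η` for which the hypothesis of `abs_sum_rate_le` is exactly met
  set η := (ε / 2) * (κ * (q / 2)) / (κ + 1 + c * B + (ε / 2) * B) with hη
  have hden : 0 < κ + 1 + c * B + (ε / 2) * B := by positivity
  have hη0 : 0 < η := by positivity
  have hηle : η * (κ + 1 + c * B) ≤ ε / 2 * (κ * (q / 2) - B * η) := by
    have : η * (κ + 1 + c * B + (ε / 2) * B) = (ε / 2) * (κ * (q / 2)) := by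
      rw [hη, div_mul_cancel₀ _ hden.ne']
    linarith
  obtain ⟨δ, hδ0, hδ⟩ := mem_nhdsGT_iff_exists_Ioc_subset.1
    (eventually_abs_logDeriv_laplace_sub_le ha0 ha1 (hW 0) (hnn 0) hF (B := B) hb₀ hη0)
  have hδ0' : (0 : ℝ) < δ := hδ0
  have hpq : Tendsto (fun n : ℕ => |(n : ℝ)⁻¹ * ∑ i, b n i ^ (a - 1) -
      c * ((n : ℝ)⁻¹ * ∑ i, b n i ^ a)|) atTop (𝓝 0) := by
    have := (hp.sub (hq.const_mul c)).abs
    rwa [hc, div_mul_cancel₀ _ hq0.ne', sub_self, abs_zero] at this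
  set C := 1 / b₀ + c with hC
  have hCpos : 0 < C := by positivity
  have hexp := (tendsto_integral_exp_sum hW hnn hind hid hpos
    (mul_pos hδ0' hb₀)).const_mul C
  rw [mul_zero] at hexp
  filter_upwards [hb, hpq.eventually (gt_mem_nhds hη0),
    hq.eventually (lt_mem_nhds (half_lt_self hq0)), hexp.eventually (gt_mem_nhds hε2),
    eventually_gt_atTop 0] with n hbn hpqn hqn hexpn hn
  have hbpos : ∀ i, 0 < b n i := fun i => hb₀.trans_le (hbn i).1
  have hT0 : ∀ ω, 0 ≤ ∑ i : Fin n, b n i * W i ω := fun ω =>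
    Finset.sum_nonneg fun i _ => mul_nonneg (hbpos i).le (hnn i ω)
  rw [Real.dist_eq, sub_zero]
  have hbd := abs_integral_div_le (P := P) (D := fun ω => ∑ i : Fin n, (1 - c * b n i) * W i ω)
    (T := fun ω => ∑ i : Fin n, b n i * W i ω) (by fun_prop) (by fun_prop) hT0 hδ0' hε2.le
    (C := C) (fun ω => ?_) (fun l hl => ?_) hCpos.le
  · refine hbd.trans_lt ?_
    have : ∫ ω, Real.exp (-(δ * ∑ i : Fin n, b n i * W i ω)) ∂P ≤
        ∫ ω, Real.exp (-(δ * b₀ * ∑ i : Fin n, W i ω)) ∂P := by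
      refine integral_mono (integrable_exp_neg_mul (W := fun ω => ∑ i : Fin n, b n i * W i ω)
          (by fun_prop) hT0 hδ0'.le)
        (integrable_exp_neg_mul (W := fun ω => ∑ i : Fin n, W i ω) (by fun_prop)
          (fun ω => Finset.sum_nonneg fun i _ => hnn i ω) (by positivity)) fun ω => ?_
      refine Real.exp_le_exp.2 (neg_le_neg ?_)
      rw [mul_assoc, Finset.mul_sum]
      refine mul_le_mul_of_nonneg_left (Finset.sum_le_sum fun i _ => ?_) hδ0'.le
      exact mul_le_mul_of_nonneg_right (hbn i).1 (hnn i ω)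
    have := mul_le_mul_of_nonneg_left this hCpos.le
    linarith
  · exact abs_sum_one_sub_mul_le hb₀ (fun i => (hbn i).1) hc0 fun i => hnn i ω
  · have e : ∀ ω, Real.exp (-(l * ∑ i : Fin n, b n i * W i ω)) =
        Real.exp (-(∑ i : Fin n, l * b n i * W i ω)) := by
      intro ω; simp_rw [Finset.mul_sum, mul_assoc]
    have hs : ∀ i, 0 < l * b n i := fun i => mul_pos hl.1 (hbpos i)
    simp_rw [e]
    rw [integral_sum_mul_exp_sum hW hnn hind hid hs, integral_sum_mul_exp_sum hW hnn hind hid hs,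
      abs_mul, abs_of_nonneg (Finset.prod_nonneg fun i _ => integral_nonneg fun _ =>
        (Real.exp_pos _).le), mul_left_comm (ε / 2)]
    refine mul_le_mul_of_nonneg_left ?_ (Finset.prod_nonneg fun i _ => integral_nonneg fun _ =>
        (Real.exp_pos _).le)
    exact abs_sum_rate_le hb₀ hbn hc0 hκ.le (mul_pos (inv_pos.2 hl.1) (hF.pos (1 / l)))
      hε2.le (fun i => hδ hl (b n i) (hbn i)) hpqn.le hqn.le hηle hn
/-- The limit of the mean of a ratio of two weighted sums of heavy-tailed variables with infinite
mean: it only depends on the averages of `b ^ (a - 1)` and of `b ^ a`. -/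
theorem tendsto_integral_sum_div_sum {a : ℝ} (ha0 : 0 < a) (ha1 : a < 1)
    (hW : ∀ j, Measurable (W j)) (hnn : ∀ j ω, 0 ≤ W j ω)
    (hind : iIndepFun W P) (hid : ∀ j, IdentDistrib (W j) (W 0) P P)
    (hF : IsRegularTail (fun x => P.real {ω | x < W 0 ω}) a)
    (b : (n : ℕ) → Fin n → ℝ) {b₀ B p q : ℝ} (hb₀ : 0 < b₀)
    (hb : ∀ᶠ n in atTop, ∀ i, b n i ∈ Set.Icc b₀ B)
    (hp : Tendsto (fun n : ℕ => (n : ℝ)⁻¹ * ∑ i, b n i ^ (a - 1)) atTop (𝓝 p))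
    (hq : Tendsto (fun n : ℕ => (n : ℝ)⁻¹ * ∑ i, b n i ^ a) atTop (𝓝 q)) (hp0 : 0 ≤ p)
    (hq0 : 0 < q) :
    Tendsto (fun n : ℕ => ∫ ω, (∑ i : Fin n, W i ω) / (∑ i : Fin n, b n i * W i ω) ∂P) atTop
      (𝓝 (p / q)) := by
  have hmain := tendsto_integral_sum_one_sub_mul_div_sum ha0 ha1 hW hnn hind hid hF b hb₀ hb hp hq
    hp0 hq0
  have hpos : 0 < P.real {ω | 0 < W 0 ω} := hF.pos 0
  set c := p / q with hc
  have hc0 : 0 ≤ c := div_nonneg hp0 hq0.le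
  -- on `∑ W = 0` both quotients take the junk value `0`, whence the correction by that event
  have hz := tendsto_measure_sum_eq_zero hW hnn hind hid hpos
  have hfin := hmain.add ((hz.const_sub 1).const_mul c)
  rw [sub_zero, mul_one, zero_add] at hfin
  refine hfin.congr' ?_
  filter_upwards [hb] with n hbn
  have hbpos : ∀ i, 0 < b n i := fun i => hb₀.trans_le (hbn i).1
  have hm : MeasurableSet {ω | ∑ i : Fin n, W i ω = 0} :=
    measurableSet_eq_fun (Finset.measurable_sum _ fun i _ => hW i) measurable_const
  have hbound : ∀ ω, |(∑ i : Fin n, (1 - c * b n i) * W i ω) / (∑ i : Fin n, b n i * W i ω)| ≤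
      1 / b₀ + c := by
    intro ω
    have hT0 : 0 ≤ ∑ i : Fin n, b n i * W i ω :=
      Finset.sum_nonneg fun i _ => mul_nonneg (hbpos i).le (hnn i ω)
    rcases hT0.eq_or_lt with h0 | h0
    · rw [← h0, div_zero, abs_zero]; positivity
    rw [abs_div, abs_of_pos h0, div_le_iff₀ h0]
    exact abs_sum_one_sub_mul_le hb₀ (fun i => (hbn i).1) hc0 fun i => hnn i ω
  rw [← probReal_compl_eq_one_sub hm, ← integral_indicator_one hm.compl]
  change _ + c * ∫ ω, {ω | ∑ i : Fin n, W i ω = 0}ᶜ.indicator (fun _ => (1 : ℝ)) ω ∂P = _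
  rw [← integral_const_mul,
    ← integral_add (Integrable.of_bound (Measurable.aestronglyMeasurable (by fun_prop)) (1 / b₀ + c)
      (Eventually.of_forall hbound)) (((integrable_const 1).indicator hm.compl).const_mul c)]
  refine integral_congr_ae (Eventually.of_forall fun ω => ?_)
  have hS0 : 0 ≤ ∑ i : Fin n, W i ω := Finset.sum_nonneg fun i _ => hnn i ω
  have hD : ∑ i : Fin n, (1 - c * b n i) * W i ω =
      ∑ i : Fin n, W i ω - c * ∑ i : Fin n, b n i * W i ω := by
    rw [Finset.mul_sum, ← Finset.sum_sub_distrib]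
    exact Finset.sum_congr rfl fun i _ => by ring
  simp only [hD]
  by_cases h : ∑ i : Fin n, W i ω = 0
  · rw [Set.indicator_of_notMem (by simpa using h)]
    have h' : ∀ i : Fin n, W i ω = 0 := fun i =>
      (Finset.sum_eq_zero_iff_of_nonneg (f := fun i : Fin n => W i ω) fun i _ => hnn i ω).1 h i
        (Finset.mem_univ i)
    simp [h']
  · rw [Set.indicator_of_mem (by simpa using h)]
    have hT : 0 < ∑ i : Fin n, b n i * W i ω := by
      have hSpos : 0 < ∑ i : Fin n, W i ω := lt_of_le_of_ne hS0 (Ne.symm h)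
      refine lt_of_lt_of_le (mul_pos hb₀ hSpos) ?_
      rw [Finset.mul_sum]
      exact Finset.sum_le_sum fun i _ => mul_le_mul_of_nonneg_right (hbn i).1 (hnn i ω)
    field_simp
    ring

end IID

/-! ### Moments from the transform relation -/

/-- The coefficients of `(1 - y) ^ s` in powers of `y`. -/
def binomCoeff (s : ℝ) (k : ℕ) : ℝ := Ring.choose s k * (-1) ^ k

theorem hasSum_binomCoeff (s : ℝ) {y : ℝ} (hy : |y| < 1) :
    HasSum (fun k => binomCoeff s k * y ^ k) ((1 - y) ^ s) := by
  have h := (Real.one_add_rpow_hasFPowerSeriesOnBall_zero (a := s)).hasSum (y := -y)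
    (by simpa [enorm_eq_nnnorm, ← NNReal.coe_lt_coe] using hy)
  rw [zero_add, ← sub_eq_add_neg] at h
  refine h.congr_fun fun k => ?_
  simp [binomialSeries, binomCoeff, neg_pow y]
  ring

theorem binomCoeff_zero (s : ℝ) : binomCoeff s 0 = 1 := by
  simp [binomCoeff]

theorem binomCoeff_succ (s : ℝ) (k : ℕ) :
    ((k : ℝ) + 1) * binomCoeff s (k + 1) = (k - s) * binomCoeff s k := by
  simp only [binomCoeff, Ring.choose_eq_smul, descPochhammer_succ_right, Polynomial.smeval_mul,
    Polynomial.smeval_sub, Polynomial.smeval_X, Polynomial.smeval_natCast, Nat.factorial_succ,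
    smul_eq_mul, pow_succ, pow_zero, nsmul_eq_mul, mul_one]
  have h1 : ((k : ℝ) + 1) ≠ 0 := by positivity
  have h2 : ((Nat.factorial k : ℕ) : ℝ) ≠ 0 := by positivity
  push_cast
  field_simp
  ring

theorem mul_binomCoeff_sub_one (a : ℝ) (k : ℕ) :
    a * binomCoeff (a - 1) k = (a - k) * binomCoeff a k := by
  induction k with
  | zero => simp [binomCoeff_zero]
  | succ k ih =>
    have h1 : ((k : ℝ) + 1) ≠ 0 := by positivity
    have e1 := binomCoeff_succ (a - 1) k
    have e2 := binomCoeff_succ a k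
    refine mul_left_cancel₀ h1 ?_
    push_cast
    linear_combination a * e1 + (k - (a - 1)) * ih - (a - (k + 1)) * e2

theorem neg_binomCoeff_eq_Gamma {a : ℝ} (ha1 : a < 1) (k : ℕ) :
    -binomCoeff a (k + 1) = a / Real.Gamma (1 - a) *
      (Real.Gamma (((k + 1 : ℕ) : ℝ) - a) / (Nat.factorial (k + 1) : ℝ)) := by
  have hg : Real.Gamma (1 - a) ≠ 0 := (Real.Gamma_pos_of_pos (by linarith)).ne'
  induction k with
  | zero =>
    have := binomCoeff_succ a 0
    simp [binomCoeff_zero] at this ⊢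
    rw [this]
    field_simp
  | succ k ih =>
    have h1 : ((k : ℝ) + 2) ≠ 0 := by positivity
    have h2 : ((Nat.factorial (k + 1) : ℕ) : ℝ) ≠ 0 := by positivity
    have e := binomCoeff_succ a (k + 1)
    have hk : (0 : ℝ) < ((k + 1 : ℕ) : ℝ) - a := by
      push_cast; linarith [(Nat.cast_nonneg k : (0 : ℝ) ≤ k)]
    have eg : Real.Gamma (((k + 1 + 1 : ℕ) : ℝ) - a) =
        (((k + 1 : ℕ) : ℝ) - a) * Real.Gamma (((k + 1 : ℕ) : ℝ) - a) := by
      rw [← Real.Gamma_add_one hk.ne']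
      congr 1
      push_cast; ring
    rw [eg, Nat.factorial_succ (k + 1)]
    refine mul_left_cancel₀ h1 ?_
    have e' : ((k : ℝ) + 2) * -binomCoeff a (k + 1 + 1) =
        (((k + 1 : ℕ) : ℝ) - a) * -binomCoeff a (k + 1) := by
      push_cast at e ⊢
      linear_combination -e
    rw [e', ih]
    push_cast
    field_simp
    ring

/-- Termwise integration of a power series against a compactly supported measure. -/
theorem hasSum_integral_mul_pow {ρ : Measure ℝ} [IsFiniteMeasure ρ] {K : ℝ} (hK0 : 0 ≤ K)
    (hK : ∀ᵐ x ∂ρ, |x| ≤ K) {c : ℕ → ℝ} {f : ℝ → ℝ}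
    (hc : ∀ y, |y| < 1 → HasSum (fun k => c k * y ^ k) (f y)) {w : ℝ} (hw : |w| * K < 1) :
    HasSum (fun k => c k * (∫ x, x ^ k ∂ρ) * w ^ k) (∫ x, f (w * x) ∂ρ) := by
  have hI : ∀ k, Integrable (fun x => c k * (w * x) ^ k) ρ := by
    intro k
    refine Integrable.of_bound (by fun_prop) (|c k| * (|w| * K) ^ k) ?_
    filter_upwards [hK] with x hx
    rw [norm_mul, norm_pow, Real.norm_eq_abs, Real.norm_eq_abs, abs_mul w]
    gcongr
  have hsum : Summable fun k => |c k * (|w| * K) ^ k| :=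
    (hc (|w| * K) (by rwa [abs_of_nonneg (by positivity)])).summable.abs
  have h := hasSum_integral_of_summable_integral_norm hI (by
    refine Summable.of_nonneg_of_le (fun k => integral_nonneg fun _ => norm_nonneg _)
      (fun k => ?_) (hsum.mul_right (ρ.real Set.univ))
    have : ∫ x, ‖c k * (w * x) ^ k‖ ∂ρ ≤ ∫ x, |c k * (|w| * K) ^ k| ∂ρ := by
      refine integral_mono_ae (hI k).norm (integrable_const _) ?_
      filter_upwards [hK] with x hx
      rw [norm_mul, norm_pow, Real.norm_eq_abs, Real.norm_eq_abs, abs_mul w, abs_mul, abs_pow,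
        abs_mul |w|, abs_abs, abs_of_nonneg hK0]
      gcongr
    refine this.trans_eq ?_
    rw [integral_const, smul_eq_mul, mul_comm])
  have e1 : ∫ x, (∑' k, c k * (w * x) ^ k) ∂ρ = ∫ x, f (w * x) ∂ρ := by
    refine integral_congr_ae ?_
    filter_upwards [hK] with x hx
    refine (hc _ ?_).tsum_eq
    rw [abs_mul]
    exact (mul_le_mul_of_nonneg_left hx (abs_nonneg w)).trans_lt hw
  rw [e1] at h
  refine h.congr_fun fun k => ?_
  simp_rw [mul_pow]
  rw [integral_const_mul, integral_const_mul]
  ring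

theorem eq_of_eventually_hasSum {A B : ℕ → ℝ} {f : ℝ → ℝ}
    (hA : ∀ᶠ w in 𝓝 (0 : ℝ), HasSum (fun k => A k * w ^ k) (f w))
    (hB : ∀ᶠ w in 𝓝 (0 : ℝ), HasSum (fun k => B k * w ^ k) (f w)) : A = B := by
  have h : ∀ C : ℕ → ℝ, (∀ᶠ w in 𝓝 (0 : ℝ), HasSum (fun k => C k * w ^ k) (f w)) →
      HasFPowerSeriesAt f (FormalMultilinearSeries.ofScalars ℝ C) 0 := by
    intro C hC
    rw [hasFPowerSeriesAt_iff]
    filter_upwards [hC] with w hw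
    simpa [mul_comm] using hw
  have := (h A hA).eq_formalMultilinearSeries (h B hB)
  funext k
  have h2 := congrArg (fun p => FormalMultilinearSeries.coeff p k) this
  simpa using h2

/-- The transform relation as an identity between formal power series. -/
theorem mk_moments_mul_eq {μ ν : Measure ℝ} [IsFiniteMeasure μ] [IsFiniteMeasure ν] {K a δ : ℝ}
    (hK0 : 0 ≤ K) (hμ : ∀ᵐ x ∂μ, |x| ≤ K) (hν : ∀ᵐ x ∂ν, |x| ≤ K) (hδ : 0 < δ)
    (h : ∀ w : ℝ, |w| < δ → (∫ x, (1 - w * x)⁻¹ ∂μ) * (∫ x, (1 - w * x) ^ a ∂ν) =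
      ∫ x, (1 - w * x) ^ (a - 1) ∂ν) :
    (PowerSeries.mk fun k => ∫ x, x ^ k ∂μ) *
      (PowerSeries.mk fun k => binomCoeff a k * ∫ x, x ^ k ∂ν) =
      PowerSeries.mk fun k => binomCoeff (a - 1) k * ∫ x, x ^ k ∂ν := by
  have hev : ∀ᶠ w in 𝓝 (0 : ℝ), |w| < δ ∧ |w| * K < 1 := by
    have h1 : Tendsto (fun w : ℝ => |w|) (𝓝 0) (𝓝 0) := by
      simpa using (continuous_abs.tendsto (0 : ℝ))
    have h2 : Tendsto (fun w : ℝ => |w| * K) (𝓝 0) (𝓝 0) := by simpa using h1.mul_const K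
    exact (h1.eventually (gt_mem_nhds hδ)).and (h2.eventually (gt_mem_nhds one_pos))
  ext n
  rw [PowerSeries.coeff_mul]
  simp only [PowerSeries.coeff_mk]
  refine congrFun (eq_of_eventually_hasSum (A := fun n => ∑ p ∈ Finset.HasAntidiagonal.antidiagonal n,
    (∫ x, x ^ p.1 ∂μ) * (binomCoeff a p.2 * ∫ x, x ^ p.2 ∂ν))
    (B := fun k => binomCoeff (a - 1) k * ∫ x, x ^ k ∂ν)
    (f := fun w => ∫ x, (1 - w * x) ^ (a - 1) ∂ν) ?_ ?_) n
  · filter_upwards [hev] with w hw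
    have h1 := hasSum_integral_mul_pow hK0 hμ (c := fun _ => 1) (f := fun y => (1 - y)⁻¹)
      (fun y hy => by simpa using hasSum_geometric_of_abs_lt_one hy) hw.2
    have h2 := hasSum_integral_mul_pow hK0 hν (fun y hy => hasSum_binomCoeff a hy) hw.2
    rw [← h w hw.1]
    have s1 := summable_norm_iff.2 h1.summable
    have s2 := summable_norm_iff.2 h2.summable
    have h3 := tsum_mul_tsum_eq_tsum_sum_antidiagonal_of_summable_norm s1 s2
    have h4 := (summable_norm_sum_mul_antidiagonal_of_summable_norm s1 s2).of_norm.hasSum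
    rw [← h3, h1.tsum_eq, h2.tsum_eq] at h4
    refine h4.congr_fun fun k => ?_
    rw [Finset.sum_mul]
    refine Finset.sum_congr rfl fun p hp => ?_
    rw [← Finset.HasAntidiagonal.mem_antidiagonal.1 hp, pow_add]
    ring
  · filter_upwards [hev] with w hw
    exact hasSum_integral_mul_pow hK0 hν (fun y hy => hasSum_binomCoeff (a - 1) hy) hw.2

theorem coeff_pow_eq_sum_compositions {C : PowerSeries ℝ} (hC : PowerSeries.coeff 0 C = 0)
    (r l : ℕ) :
    PowerSeries.coeff l (C ^ r) =
      ∑ k ∈ compositions r l, ∏ s : Fin r, PowerSeries.coeff (k s) C := by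
  have h := PowerSeries.coeff_prod (fun _ : Fin r => C) l Finset.univ
  rw [Finset.prod_const, Finset.card_univ, Fintype.card_fin] at h
  rw [h, compositions, Finset.sum_filter_of_ne]
  · refine Finset.sum_equiv Finsupp.equivFunOnFinite (fun k => ?_) (fun k _ => rfl)
    rw [Finset.mem_finsuppAntidiag, Finset.Nat.mem_antidiagonalTuple]
    simp
  · intro k _ hne s
    by_contra hs
    exact hne (Finset.prod_eq_zero (Finset.mem_univ s) (by rwa [show k s = 0 by omega]))

open PowerSeries in
/-- Solving `a (M - 1) (1 - C) = X C'`, that is `a (M - 1) = -X (log (1 - C))'`, for the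
coefficients of `M`. -/
theorem coeff_eq_sum_coeff_pow {M C : PowerSeries ℝ} {a : ℝ} (ha : a ≠ 0)
    (hM : coeff 0 M = 1) (hC : coeff 0 C = 0)
    (h : a • ((M - 1) * (1 - C)) = X * d⁄dX ℝ C) {l : ℕ} (hl : 1 ≤ l) :
    coeff l M = ∑ r ∈ Finset.Icc 1 l, a⁻¹ * ((l : ℝ) / r) * coeff l (C ^ r) := by
  have hXd : ∀ f : PowerSeries ℝ, coeff l (X * d⁄dX ℝ f) = l * coeff l f := by
    intro f
    obtain ⟨k, rfl⟩ : ∃ k, l = k + 1 := ⟨l - 1, by omega⟩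
    rw [coeff_succ_X_mul, coeff_derivative]
    push_cast
    ring
  -- multiplication by the truncated geometric series inverts `1 - C` up to order `l`
  have hgeom : (∑ r ∈ Finset.range l, C ^ r) * (1 - C) = 1 - C ^ l := geom_sum_mul_neg C l
  have hXM : X ∣ (M - 1) := X_dvd_iff.2 (by simpa [sub_eq_zero] using hM)
  have hXC : X ∣ C := X_dvd_iff.2 (by simpa using hC)
  have hdvd : (X : PowerSeries ℝ) ^ (l + 1) ∣ (M - 1) * C ^ l := by
    rw [pow_succ, mul_comm]
    exact mul_dvd_mul hXM (pow_dvd_pow_of_dvd hXC l)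
  have hz : coeff l ((M - 1) * C ^ l) = 0 := X_pow_dvd_iff.1 hdvd l (Nat.lt_succ_self l)
  have e1 : a • ((M - 1) - (M - 1) * C ^ l) =
      ∑ r ∈ Finset.range l, X * (C ^ r * d⁄dX ℝ C) := by
    have : a • ((M - 1) * ((∑ r ∈ Finset.range l, C ^ r) * (1 - C))) =
        (∑ r ∈ Finset.range l, C ^ r) * (a • ((M - 1) * (1 - C))) := by
      rw [mul_smul_comm]; congr 1; ring
    rw [hgeom, h, Finset.sum_mul] at this
    rw [show (M - 1) - (M - 1) * C ^ l = (M - 1) * (1 - C ^ l) by ring, this]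
    exact Finset.sum_congr rfl fun r _ => by ring
  have e2 := congrArg (coeff l) e1
  rw [coeff_smul, map_sub, map_sub, hz, coeff_one, if_neg (by omega), map_sum] at e2
  have e3 : ∀ r ∈ Finset.range l, coeff l (X * (C ^ r * d⁄dX ℝ C)) =
      ((l : ℝ) / (r + 1 : ℕ)) * coeff l (C ^ (r + 1)) := by
    intro r _
    have hd : d⁄dX ℝ (C ^ (r + 1)) = ((r + 1 : ℕ) : ℝ) • (C ^ r * d⁄dX ℝ C) := by
      rw [derivative_pow, Nat.add_sub_cancel, mul_assoc, Nat.cast_smul_eq_nsmul, nsmul_eq_mul]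
    have h1 := hXd (C ^ (r + 1))
    rw [hd, mul_smul_comm, coeff_smul, smul_eq_mul] at h1
    have h2 : ((r + 1 : ℕ) : ℝ) ≠ 0 := by positivity
    field_simp
    linarith
  rw [Finset.sum_congr rfl e3, sub_zero, sub_zero, smul_eq_mul] at e2
  have e4 : coeff l M = a⁻¹ * ∑ r ∈ Finset.range l,
      ((l : ℝ) / (r + 1 : ℕ)) * coeff l (C ^ (r + 1)) := by
    rw [← e2]; field_simp
  rw [e4, Finset.mul_sum, Finset.range_eq_Ico, ← Finset.Ico_add_one_right_eq_Icc,
    Finset.sum_Ico_add' (fun r : ℕ => a⁻¹ * (((l : ℝ) / r) * coeff l (C ^ r))) 0 l 1, zero_add]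
  exact Finset.sum_congr rfl fun r _ => by ring

open PowerSeries in
/-- The moments of a compactly supported measure satisfying the Markov–Krein type relation with
`ν` near the origin. -/
theorem integral_pow_eq_limitMoment {μ ν : Measure ℝ} [IsProbabilityMeasure μ]
    [IsProbabilityMeasure ν] {K α δ : ℝ} (hα0 : 0 < α) (hα2 : α < 2)
    (hK0 : 0 ≤ K) (hμ : ∀ᵐ x ∂μ, |x| ≤ K) (hν : ∀ᵐ x ∂ν, |x| ≤ K) (hδ : 0 < δ)
    (h : ∀ w : ℝ, |w| < δ → (∫ x, (1 - w * x)⁻¹ ∂μ) * (∫ x, (1 - w * x) ^ (α / 2) ∂ν) =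
      ∫ x, (1 - w * x) ^ (α / 2 - 1) ∂ν) {l : ℕ} (hl : 1 ≤ l) :
    ∫ x, x ^ l ∂μ = limitMoment ν α l := by
  set a := α / 2 with ha
  have ha0 : 0 < a := by positivity
  have ha1 : a < 1 := by rw [ha]; linarith
  have hg : Real.Gamma (1 - a) ≠ 0 := (Real.Gamma_pos_of_pos (by linarith)).ne'
  set M : PowerSeries ℝ := PowerSeries.mk fun k => ∫ x, x ^ k ∂μ with hMdef
  set F : PowerSeries ℝ := PowerSeries.mk fun k => binomCoeff a k * ∫ x, x ^ k ∂ν with hFdef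
  set C : PowerSeries ℝ := 1 - F with hCdef
  -- the coefficients of `C` are the factors in the definition of `limitMoment`, up to scaling
  have hMF := mk_moments_mul_eq hK0 hμ hν hδ h
  have hM1 : coeff 0 M = 1 := by simp [hMdef]
  have hC0 : coeff 0 C = 0 := by simp [hCdef, hFdef, binomCoeff_zero]
  have hCk : ∀ k, 1 ≤ k → coeff k C = a / Real.Gamma (1 - a) *
      (Real.Gamma ((k : ℝ) - a) / (Nat.factorial k : ℝ) * ∫ x, x ^ k ∂ν) := by
    intro k hk
    obtain ⟨j, rfl⟩ : ∃ j, k = j + 1 := ⟨k - 1, by omega⟩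
    rw [← mul_assoc, ← neg_binomCoeff_eq_Gamma ha1 j]
    simp [hCdef, hFdef, coeff_one]
  have hrel : a • ((M - 1) * (1 - C)) = X * d⁄dX ℝ C := by
    rw [hCdef, sub_sub_cancel, sub_mul, one_mul, hMF]
    ext k
    have := mul_binomCoeff_sub_one a k
    rcases k with _ | k
    · simp [hFdef, binomCoeff_zero]
    · rw [coeff_succ_X_mul, coeff_derivative]
      simp only [coeff_smul, map_sub, coeff_mk, hFdef, smul_eq_mul, coeff_one]
      rw [if_neg (by omega)]
      push_cast at this
      linear_combination (∫ x, x ^ (k + 1) ∂ν) * this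
  have hfin := coeff_eq_sum_coeff_pow ha0.ne' hM1 hC0 hrel hl
  rw [hMdef, coeff_mk] at hfin
  rw [hfin, limitMoment]
  refine Finset.sum_congr rfl fun r hr => ?_
  have hr1 : 1 ≤ r := (Finset.mem_Icc.1 hr).1
  rw [coeff_pow_eq_sum_compositions hC0]
  have e : ∀ k ∈ compositions r l, ∏ s : Fin r, coeff (k s) C =
      (a / Real.Gamma (1 - a)) ^ r * ∏ s : Fin r, (Real.Gamma ((k s : ℝ) - a) /
        (Nat.factorial (k s) : ℝ) * ∫ x : ℝ, x ^ (k s) ∂ν) := by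
    intro k hk
    rw [Finset.prod_congr rfl fun s _ => hCk (k s) ((Finset.mem_filter.1 hk).2 s),
      Finset.prod_mul_distrib, Finset.prod_const, Finset.card_univ, Fintype.card_fin]
  rw [Finset.sum_congr rfl e, ← Finset.mul_sum, ← mul_assoc, ← ha]
  congr 1
  obtain ⟨j, rfl⟩ : ∃ j, r = j + 1 := ⟨r - 1, by omega⟩
  rw [Nat.add_sub_cancel, div_pow, pow_succ a]
  have : ((j + 1 : ℕ) : ℝ) ≠ 0 := by positivity
  field_simp

/-! ### Determinacy of the moment problem -/

/-- If the even moments of `μ` are at most those of the point mass at `K`, then, by Markov's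
inequality for `x ^ (2 * l)` with `l → ∞`, `μ` does not charge `|x| ≥ R` for any `R > K`. -/
theorem measureReal_abs_ge_eq_zero_of_moments {μ : Measure ℝ} [IsProbabilityMeasure μ] {K R : ℝ}
    (hK0 : 0 ≤ K) (hR : K < R) (hint : ∀ l : ℕ, 1 ≤ l → Integrable (fun x : ℝ => x ^ l) μ)
    (hmom : ∀ l : ℕ, 1 ≤ l → ∫ x, x ^ (2 * l) ∂μ ≤ K ^ (2 * l)) :
    μ.real {x | R ≤ |x|} = 0 := by
  have hR0 : 0 < R := hK0.trans_lt hR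
  have hq : (K / R) ^ 2 < 1 := by
    rw [div_pow, div_lt_one (by positivity)]
    exact pow_lt_pow_left₀ hR hK0 two_ne_zero
  refine le_antisymm (ge_of_tendsto (tendsto_pow_atTop_nhds_zero_of_lt_one (sq_nonneg _) hq) ?_)
    measureReal_nonneg
  filter_upwards [eventually_ge_atTop 1] with l hl
  have h := mul_meas_ge_le_integral_of_nonneg (μ := μ) (f := fun x : ℝ => x ^ (2 * l))
    (Eventually.of_forall fun x => Even.pow_nonneg (even_two_mul l) x) (hint (2 * l) (by omega))
    (R ^ (2 * l))
  have hs : μ.real {x : ℝ | R ≤ |x|} ≤ μ.real {x : ℝ | R ^ (2 * l) ≤ x ^ (2 * l)} := by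
    refine measureReal_mono fun x hx => ?_
    have hx' : R ≤ |x| := hx
    change R ^ (2 * l) ≤ x ^ (2 * l)
    rw [← Even.pow_abs (even_two_mul l) x]
    exact pow_le_pow_left₀ hR0.le hx' _
  rw [← pow_mul, div_pow, le_div_iff₀ (by positivity)]
  calc _ ≤ μ.real {x : ℝ | R ^ (2 * l) ≤ x ^ (2 * l)} * R ^ (2 * l) := by gcongr
    _ ≤ _ := by rw [mul_comm]; exact h.trans (hmom l hl)

theorem integrable_pow_of_ae_abs_le {μ : Measure ℝ} [IsFiniteMeasure μ] {K : ℝ}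
    (hμ : ∀ᵐ x ∂μ, |x| ≤ K) (l : ℕ) : Integrable (fun x : ℝ => x ^ l) μ := by
  refine Integrable.of_bound (by fun_prop) (K ^ l) ?_
  filter_upwards [hμ] with x hx
  rw [norm_pow, Real.norm_eq_abs]
  gcongr

/-- The Hausdorff moment problem is determinate, also among measures that are not assumed to have
bounded support: the growth of the even moments forces the support to be bounded. -/
theorem eq_of_forall_integral_pow_eq {μ μ' : Measure ℝ} [IsProbabilityMeasure μ]
    [IsProbabilityMeasure μ'] {K : ℝ} (hK0 : 0 ≤ K) (hμ : ∀ᵐ x ∂μ, |x| ≤ K)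
    (hint : ∀ l : ℕ, 1 ≤ l → Integrable (fun x : ℝ => x ^ l) μ')
    (hmom : ∀ l : ℕ, 1 ≤ l → ∫ x, x ^ l ∂μ' = ∫ x, x ^ l ∂μ) : μ' = μ := by
  have hμ' : ∀ᵐ x ∂μ', |x| ≤ K + 1 := by
    have h0 := measureReal_abs_ge_eq_zero_of_moments hK0 (lt_add_one K) hint (fun l hl => by
      rw [hmom (2 * l) (by omega)]
      have : ∫ x, x ^ (2 * l) ∂μ ≤ ∫ _, K ^ (2 * l) ∂μ := by
        refine integral_mono_ae (integrable_pow_of_ae_abs_le hμ _) (integrable_const _) ?_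
        filter_upwards [hμ] with x hx
        rw [← Even.pow_abs (even_two_mul l) x]
        exact pow_le_pow_left₀ (abs_nonneg x) hx _
      simpa using this)
    rw [measureReal_eq_zero_iff] at h0
    filter_upwards [measure_eq_zero_iff_ae_notMem.1 h0] with x hx
    exact (not_le.1 hx).le
  have hμ1 : ∀ᵐ x ∂μ, |x| ≤ K + 1 := by
    filter_upwards [hμ] with x hx; linarith
  have hpoly : ∀ p : Polynomial ℝ, ∫ x, p.eval x ∂μ' = ∫ x, p.eval x ∂μ := by
    intro p
    simp_rw [Polynomial.eval_eq_sum_range]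
    rw [integral_finsetSum _ fun i _ => (integrable_pow_of_ae_abs_le hμ' i).const_mul _,
      integral_finsetSum _ fun i _ => (integrable_pow_of_ae_abs_le hμ i).const_mul _]
    refine Finset.sum_congr rfl fun i _ => ?_
    rw [integral_const_mul, integral_const_mul]
    rcases Nat.eq_zero_or_pos i with rfl | hi
    · simp
    · rw [hmom i hi]
  refine ext_of_forall_integral_eq_of_IsFiniteMeasure fun f => ?_
  refine eq_of_forall_dist_le fun ε hε => ?_
  obtain ⟨p, hp⟩ := exists_polynomial_near_of_continuousOn (-(K + 1)) (K + 1) f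
    f.continuous.continuousOn (ε / 2) (by positivity)
  have hIp : ∀ ρ : Measure ℝ, IsProbabilityMeasure ρ → (∀ᵐ x ∂ρ, |x| ≤ K + 1) →
      |∫ x, f x ∂ρ - ∫ x, p.eval x ∂ρ| ≤ ε / 2 := by
    intro ρ _ hρ
    have hpi : Integrable (fun x => p.eval x) ρ := by
      simp_rw [Polynomial.eval_eq_sum_range]
      exact integrable_finsetSum _ fun i _ => (integrable_pow_of_ae_abs_le hρ i).const_mul _
    rw [← integral_sub (f.integrable ρ) hpi, ← Real.norm_eq_abs]
    have := norm_integral_le_of_norm_le_const (μ := ρ) (f := fun x => f x - p.eval x)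
      (C := ε / 2) (by
        filter_upwards [hρ] with x hx
        rw [Real.norm_eq_abs, abs_sub_comm]
        exact (hp x (abs_le.1 hx)).le)
    simpa using this
  rw [Real.dist_eq]
  have h1 := abs_le.1 (hIp μ' inferInstance hμ')
  have h2 := abs_le.1 (hIp μ inferInstance hμ1)
  have h3 := hpoly p
  rw [abs_le]
  constructor <;> linarith [h1.1, h1.2, h2.1, h2.2]

/-! ### The Stieltjes transform in the complex plane -/

open Complex in
theorem sub_ofReal_mem_slitPlane {z : ℂ} {d x : ℝ} (hz : z - d ∈ slitPlane) (hx : x ≤ d) :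
    z - x ∈ slitPlane := by
  rw [mem_slitPlane_iff] at hz ⊢
  simp only [sub_re, ofReal_re, sub_im, ofReal_im, sub_zero] at hz ⊢
  rcases hz with h | h
  · exact Or.inl (by linarith)
  · exact Or.inr h

open Complex in
/-- `z ↦ ∫ (z - x) ^ s ρ(dx)` is holomorphic off the half-line to the left of the support. -/
theorem differentiableOn_integral_cpow {ρ : Measure ℝ} [IsFiniteMeasure ρ] {c d : ℝ}
    (hρ : ∀ᵐ x ∂ρ, x ∈ Set.Icc c d) (s : ℂ) :
    DifferentiableOn ℂ (fun z : ℂ => ∫ x, (z - (x : ℂ)) ^ s ∂ρ) {z : ℂ | z - d ∈ slitPlane} := by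
  have hU : IsOpen {z : ℂ | z - d ∈ slitPlane} :=
    isOpen_slitPlane.preimage (continuous_id.sub continuous_const)
  intro z₀ hz₀
  obtain ⟨r, hr, hball⟩ := Metric.nhds_basis_closedBall.mem_iff.1 (hU.mem_nhds hz₀)
  have hmeas : ∀ (z t : ℂ), AEStronglyMeasurable (fun x : ℝ => (z - (x : ℂ)) ^ t) ρ := by
    intro z t
    have : Measurable fun x : ℝ => (z - (x : ℂ)) ^ t :=
      (measurable_const.sub Complex.measurable_ofReal).pow_const t
    exact this.aestronglyMeasurable
  have hcont : ∀ t : ℂ, ContinuousOn (fun p : ℂ × ℝ => (p.1 - (p.2 : ℂ)) ^ t)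
      (Metric.closedBall z₀ r ×ˢ Set.Icc c d) := by
    intro t
    refine ContinuousOn.cpow (by fun_prop) continuousOn_const fun p hp => ?_
    exact sub_ofReal_mem_slitPlane (hball hp.1) hp.2.2
  have hcpt : IsCompact (Metric.closedBall z₀ r ×ˢ Set.Icc c d) :=
    (isCompact_closedBall z₀ r).prod isCompact_Icc
  obtain ⟨C₀, hC₀⟩ := hcpt.exists_bound_of_continuousOn (hcont s)
  obtain ⟨C₁, hC₁⟩ := hcpt.exists_bound_of_continuousOn (hcont (s - 1))
  have h := hasDerivAt_integral_of_dominated_loc_of_deriv_le (μ := ρ) (𝕜 := ℂ)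
    (F := fun (z : ℂ) (x : ℝ) => (z - (x : ℂ)) ^ s)
    (F' := fun (z : ℂ) (x : ℝ) => s * (z - (x : ℂ)) ^ (s - 1)) (x₀ := z₀)
    (bound := fun _ => ‖s‖ * C₁) (Metric.closedBall_mem_nhds z₀ hr)
    (Eventually.of_forall fun z => hmeas z s)
    (Integrable.of_bound (hmeas z₀ s) C₀ (by
      filter_upwards [hρ] with x hx
      exact hC₀ (z₀, x) ⟨Metric.mem_closedBall_self hr.le, hx⟩))
    ((hmeas z₀ (s - 1)).const_mul s)
    (by
      filter_upwards [hρ] with x hx z hz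
      rw [norm_mul]
      exact mul_le_mul_of_nonneg_left (hC₁ (z, x) ⟨hz, hx⟩) (norm_nonneg s))
    (integrable_const _)
    (by
      filter_upwards [hρ] with x hx z hz
      have h1 : HasDerivAt (fun z : ℂ => z - (x : ℂ)) 1 z := (hasDerivAt_id z).sub_const _
      simpa using h1.cpow_const (c := s) (sub_ofReal_mem_slitPlane (hball hz) hx.2))
  exact h.2.differentiableAt.differentiableWithinAt

open Complex in
theorem integral_cpow_ofReal_eq {ρ : Measure ℝ} {K t : ℝ} (ht : 0 < t) (hKt : K < t)
    (hρ : ∀ᵐ x ∂ρ, |x| ≤ K) (s : ℝ) :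
    ∫ x, ((t : ℂ) - (x : ℂ)) ^ (s : ℂ) ∂ρ =
      ((t ^ s * ∫ x, (1 - t⁻¹ * x) ^ s ∂ρ : ℝ) : ℂ) := by
  rw [← integral_const_mul, ← integral_complex_ofReal]
  refine integral_congr_ae ?_
  filter_upwards [hρ] with x hx
  have hx1 := (abs_le.1 hx).2
  have hpos : 0 < 1 - t⁻¹ * x := by
    rw [sub_pos, inv_mul_lt_iff₀ ht]; linarith
  rw [← ofReal_sub, ← ofReal_cpow (by linarith), ← Real.mul_rpow ht.le hpos.le]
  congr 2
  field_simp

open Complex in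
/-- Analytic continuation of the Markov–Krein type relation from a neighbourhood of infinity on
the positive real axis. -/
theorem integral_cpow_relation {μ ν : Measure ℝ} [IsProbabilityMeasure μ] [IsProbabilityMeasure ν]
    {c d a δ : ℝ} (hμ : ∀ᵐ x ∂μ, x ∈ Set.Icc c d) (hν : ∀ᵐ x ∂ν, x ∈ Set.Icc c d) (hδ : 0 < δ)
    (h : ∀ w : ℝ, |w| < δ → (∫ x, (1 - w * x)⁻¹ ∂μ) * (∫ x, (1 - w * x) ^ a ∂ν) =
      ∫ x, (1 - w * x) ^ (a - 1) ∂ν) {z : ℂ} (hz : z - d ∈ slitPlane) :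
    (∫ x, (z - (x : ℂ)) ^ (-1 : ℂ) ∂μ) * (∫ x, (z - (x : ℂ)) ^ (a : ℂ) ∂ν) =
      ∫ x, (z - (x : ℂ)) ^ ((a : ℂ) - 1) ∂ν := by
  set U : Set ℂ := {z : ℂ | z - d ∈ slitPlane} with hUdef
  have hU : IsOpen U := isOpen_slitPlane.preimage (continuous_id.sub continuous_const)
  have hUc : IsPreconnected U := by
    have h1 : IsPreconnected slitPlane :=
      (starConvex_one_slitPlane.isPathConnected one_mem_slitPlane).isConnected.isPreconnected
    have h2 := h1.image (fun z => z + (d : ℂ)) (by fun_prop)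
    convert! h2 using 1
    ext w
    simp only [hUdef, Set.mem_image]
    constructor
    · intro hw; exact ⟨w - d, hw, by ring⟩
    · rintro ⟨v, hv, rfl⟩; change v + d - d ∈ slitPlane; simpa using hv
  set f : ℂ → ℂ := fun z => (∫ x, (z - (x : ℂ)) ^ (-1 : ℂ) ∂μ) *
    (∫ x, (z - (x : ℂ)) ^ (a : ℂ) ∂ν) - ∫ x, (z - (x : ℂ)) ^ ((a : ℂ) - 1) ∂ν with hf
  have hfan : AnalyticOnNhd ℂ f U :=
    (((differentiableOn_integral_cpow hμ _).mul (differentiableOn_integral_cpow hν _)).sub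
      (differentiableOn_integral_cpow hν _)).analyticOnNhd hU
  set K := max |c| |d| with hK
  have habs : ∀ x ∈ Set.Icc c d, |x| ≤ K := fun x hx => abs_le_max_abs_abs hx.1 hx.2
  have hμK : ∀ᵐ x ∂μ, |x| ≤ K := hμ.mono habs
  have hνK : ∀ᵐ x ∂ν, |x| ≤ K := hν.mono habs
  have hK0 : 0 ≤ K := (abs_nonneg c).trans (le_max_left _ _)
  have hreal : ∀ t : ℝ, K < t → δ⁻¹ < t → f t = 0 := by
    intro t hKt hδt
    have ht : 0 < t := hK0.trans_lt hKt
    have hw : |t⁻¹| < δ := by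
      rw [abs_of_pos (inv_pos.2 ht)]; exact inv_lt_of_inv_lt₀ hδ hδt
    have h1 := integral_cpow_ofReal_eq ht hKt hμK (-1)
    have h2 := integral_cpow_ofReal_eq ht hKt hνK a
    have h3 := integral_cpow_ofReal_eq ht hKt hνK (a - 1)
    rw [ofReal_neg, ofReal_one] at h1
    rw [ofReal_sub, ofReal_one] at h3
    simp only [hf]
    rw [h1, h2, h3, ← ofReal_mul, ← ofReal_sub, ← h _ hw, Real.rpow_sub_one ht.ne',
      Real.rpow_neg_one]
    simp_rw [Real.rpow_neg_one]
    rw [ofReal_eq_zero]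
    ring
  set t₀ := max K δ⁻¹ + 1 with ht₀
  have ht₀K : K < t₀ := lt_of_le_of_lt (le_max_left _ _) (lt_add_one _)
  have ht₀δ : δ⁻¹ < t₀ := lt_of_le_of_lt (le_max_right _ _) (lt_add_one _)
  have hzU : (t₀ : ℂ) ∈ U := by
    refine Or.inl ?_
    have : d ≤ K := (le_abs_self d).trans (le_max_right _ _)
    simp only [sub_re, ofReal_re]
    linarith
  have hfreq : ∃ᶠ w in 𝓝[≠] (t₀ : ℂ), f w = 0 := by
    have htend : Tendsto (fun t : ℝ => (t : ℂ)) (𝓝[≠] t₀) (𝓝[≠] (t₀ : ℂ)) := by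
      refine tendsto_nhdsWithin_iff.2 ⟨(continuous_ofReal.tendsto t₀).mono_left
        nhdsWithin_le_nhds, ?_⟩
      filter_upwards [self_mem_nhdsWithin] with t ht
      exact fun h => ht (ofReal_injective h)
    refine htend.frequently (Eventually.frequently ?_)
    have h1 := (lt_mem_nhds ht₀K).and (lt_mem_nhds ht₀δ)
    filter_upwards [nhdsWithin_le_nhds h1] with t ht
    exact hreal t ht.1 ht.2
  exact sub_eq_zero.1 (hfan.eqOn_zero_of_preconnected_of_frequently_eq_zero hUc hzU hfreq hz)

open Complex in
theorem integrable_cpow_of_notMem {ρ : Measure ℝ} [IsFiniteMeasure ρ] {c d : ℝ}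
    (hρ : ∀ᵐ x ∂ρ, x ∈ Set.Icc c d) {z : ℂ} (hz : z ∉ ((↑) : ℝ → ℂ) '' Set.Icc c d) (s : ℝ) :
    Integrable (fun x : ℝ => (z - (x : ℂ)) ^ (s : ℂ)) ρ := by
  have hc : ContinuousOn (fun x : ℝ => ‖z - (x : ℂ)‖ ^ s) (Set.Icc c d) := by
    refine ContinuousOn.rpow_const (by fun_prop) fun x hx => Or.inl ?_
    rw [norm_ne_zero_iff, sub_ne_zero]
    rintro rfl
    exact hz ⟨x, hx, rfl⟩
  obtain ⟨C, hC⟩ := isCompact_Icc.exists_bound_of_continuousOn hc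
  refine Integrable.of_bound
    ((measurable_const.sub Complex.measurable_ofReal).pow_const _).aestronglyMeasurable C ?_
  filter_upwards [hρ] with x hx
  rw [norm_cpow_real]
  exact (le_abs_self _).trans (hC x hx)

open Complex in
/-- For non-real `w` and `0 < a < 1`, the power `w ^ a` lies in the same open half-plane as `w`. -/
theorem im_mul_im_cpow_pos {w : ℂ} (hw : w.im ≠ 0) {a : ℝ} (ha0 : 0 < a) (ha1 : a < 1) :
    0 < w.im * (w ^ (a : ℂ)).im := by
  have hw0 : w ≠ 0 := by rintro rfl; simp at hw
  have e : (w ^ (a : ℂ)).im = Real.exp (Real.log ‖w‖ * a) * Real.sin (arg w * a) := by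
    rw [cpow_def_of_ne_zero hw0, exp_im]
    simp [mul_re, mul_im, log_re, log_im]
  rw [e]
  have hn : 0 < ‖w‖ := norm_pos_iff.2 hw0
  have him : w.im = ‖w‖ * Real.sin (arg w) := by rw [sin_arg]; field_simp
  have hle := arg_le_pi w
  have hge := neg_pi_lt_arg w
  have hexp := Real.exp_pos (Real.log ‖w‖ * a)
  rcases lt_or_gt_of_ne hw with h | h
  · have harg : arg w < 0 := arg_neg_iff.2 h
    have hs : Real.sin (arg w * a) < 0 := by
      refine Real.sin_neg_of_neg_of_neg_pi_lt (mul_neg_of_neg_of_pos harg ha0) ?_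
      nlinarith
    exact mul_pos_of_neg_of_neg h (mul_neg_of_pos_of_neg hexp hs)
  · have harg : 0 < arg w := by
      refine lt_of_le_of_ne (arg_nonneg_iff.2 h.le) fun h0 => ?_
      rw [him, ← h0, Real.sin_zero, mul_zero] at h
      exact lt_irrefl _ h
    have hs : 0 < Real.sin (arg w * a) := by
      refine Real.sin_pos_of_pos_of_lt_pi (mul_pos harg ha0) ?_
      nlinarith [Real.pi_pos]
    exact mul_pos h (mul_pos hexp hs)

theorem integral_pos_of_ae_pos {X : Type*} [MeasurableSpace X] {ρ : Measure X}
    [IsProbabilityMeasure ρ] {f : X → ℝ} (hf : Integrable f ρ) (hpos : ∀ᵐ x ∂ρ, 0 < f x) :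
    0 < ∫ x, f x ∂ρ := by
  rw [integral_pos_iff_support_of_nonneg_ae (hpos.mono fun x hx => hx.le) hf]
  refine pos_iff_ne_zero.2 fun h => ?_
  obtain ⟨x, hx0, hx⟩ := ((measure_eq_zero_iff_ae_notMem.1 h).and hpos).exists
  exact hx0 hx.ne'

open Complex in
theorem integral_cpow_ne_zero {ρ : Measure ℝ} [IsProbabilityMeasure ρ] {c d : ℝ}
    (hρ : ∀ᵐ x ∂ρ, x ∈ Set.Icc c d) {a : ℝ} (ha0 : 0 < a) (ha1 : a < 1) {z : ℂ}
    (hz : z - d ∈ slitPlane) :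
    ∫ x, (z - (x : ℂ)) ^ (a : ℂ) ∂ρ ≠ 0 := by
  have hz' : z ∉ ((↑) : ℝ → ℂ) '' Set.Icc c d := by
    rintro ⟨x, hx, rfl⟩
    have := sub_ofReal_mem_slitPlane hz hx.2
    rw [sub_self] at this
    exact zero_notMem_slitPlane this
  have hI := integrable_cpow_of_notMem hρ hz' a
  intro h0
  by_cases him : z.im = 0
  · have hre : d < z.re := by
      rcases hz with h | h
      · simpa using h
      · simp [him] at h
    have hzre : z = (z.re : ℂ) := by apply Complex.ext <;> simp [him]
    have e : ∀ᵐ x : ℝ ∂ρ, 0 < ((z - (x : ℂ)) ^ (a : ℂ)).re := by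
      filter_upwards [hρ] with x hx
      rw [hzre, ← ofReal_sub, ← ofReal_cpow (by linarith [hx.2]), ofReal_re]
      exact Real.rpow_pos_of_pos (by linarith [hx.2]) _
    have hp := integral_pos_of_ae_pos (reCLM.integrable_comp hI) e
    have := reCLM.integral_comp_comm hI
    simp only [reCLM_apply] at this hp
    rw [this, h0] at hp
    simp at hp
  · have e : ∀ᵐ x : ℝ ∂ρ, 0 < z.im * ((z - (x : ℂ)) ^ (a : ℂ)).im := by
      refine Eventually.of_forall fun x => ?_
      have := im_mul_im_cpow_pos (w := z - x) (by simpa using him) ha0 ha1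
      simpa using this
    have hp := integral_pos_of_ae_pos ((imCLM.integrable_comp hI).const_mul z.im) e
    have := imCLM.integral_comp_comm hI
    simp only [imCLM_apply] at this hp
    rw [integral_const_mul, this, h0] at hp
    simp at hp

theorem stieltjesTransform_eq_neg_integral_cpow (μ : Measure ℝ) (z : ℂ) :
    stieltjesTransform μ z = -∫ x : ℝ, (z - (x : ℂ)) ^ (-1 : ℂ) ∂μ := by
  rw [stieltjesTransform_eq, ← integral_neg]
  congr 1; ext x
  rw [Complex.cpow_neg_one, one_div, ← inv_neg, neg_sub]

open Complex in
/-- The formula for the Stieltjes transform everywhere off the interval `[c, d]`. To the right of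
`d`, and off the real axis, it is obtained by analytic continuation; the real points to the left of
`c` are treated by reflection, the phases of the principal powers cancelling in the quotient. -/
theorem stieltjesTransform_eq_of_relation {μ ν : Measure ℝ} [IsProbabilityMeasure μ]
    [IsProbabilityMeasure ν] {c d a δ : ℝ} (hμ : ∀ᵐ x ∂μ, x ∈ Set.Icc c d)
    (hν : ∀ᵐ x ∂ν, x ∈ Set.Icc c d) (ha0 : 0 < a) (ha1 : a < 1) (hδ : 0 < δ)
    (h : ∀ w : ℝ, |w| < δ → (∫ x, (1 - w * x)⁻¹ ∂μ) * (∫ x, (1 - w * x) ^ a ∂ν) =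
      ∫ x, (1 - w * x) ^ (a - 1) ∂ν) {z : ℂ} (hz : z ∉ ((↑) : ℝ → ℂ) '' Set.Icc c d) :
    ∫ x, (z - (x : ℂ)) ^ (a : ℂ) ∂ν ≠ 0 ∧
      stieltjesTransform μ z =
        -((∫ x, (z - (x : ℂ)) ^ ((a : ℂ) - 1) ∂ν) / ∫ x, (z - (x : ℂ)) ^ (a : ℂ) ∂ν) := by
  by_cases hzd : z - d ∈ slitPlane
  · have hne := integral_cpow_ne_zero hν ha0 ha1 hzd
    refine ⟨hne, ?_⟩
    rw [stieltjesTransform_eq_neg_integral_cpow, ← integral_cpow_relation hμ hν hδ h hzd,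
      mul_div_cancel_right₀ _ hne]
  · -- here `z = t` is real and `t < c`
    rw [mem_slitPlane_iff, not_or, not_lt, not_not] at hzd
    simp only [sub_re, ofReal_re, sub_im, ofReal_im, sub_zero] at hzd
    obtain ⟨t, rfl⟩ : ∃ t : ℝ, z = t := ⟨z.re, by apply Complex.ext <;> simp [hzd.2]⟩
    have htd : t ≤ d := by simpa using hzd.1
    have htc : t < c := by
      by_contra hcon
      exact hz ⟨t, ⟨not_lt.1 hcon, htd⟩, rfl⟩
    have hmn : MeasurableEmbedding (fun x : ℝ => -x) := (Homeomorph.neg ℝ).measurableEmbedding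
    have hprob : ∀ ρ : Measure ℝ, IsProbabilityMeasure ρ →
        IsProbabilityMeasure (ρ.map fun x : ℝ => -x) := fun ρ _ =>
      Measure.isProbabilityMeasure_map measurable_neg.aemeasurable
    have := hprob μ inferInstance
    have := hprob ν inferInstance
    have hsupp : ∀ ρ : Measure ℝ, (∀ᵐ x ∂ρ, x ∈ Set.Icc c d) →
        ∀ᵐ x ∂(ρ.map fun x : ℝ => -x), x ∈ Set.Icc (-d) (-c) := by
      intro ρ hρ
      rw [hmn.ae_map_iff]
      filter_upwards [hρ] with x hx
      exact ⟨neg_le_neg hx.2, neg_le_neg hx.1⟩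
    have hrel : ∀ w : ℝ, |w| < δ → (∫ x, (1 - w * x)⁻¹ ∂(μ.map fun x : ℝ => -x)) *
        (∫ x, (1 - w * x) ^ a ∂(ν.map fun x : ℝ => -x)) =
        ∫ x, (1 - w * x) ^ (a - 1) ∂(ν.map fun x : ℝ => -x) := by
      intro w hw
      rw [hmn.integral_map, hmn.integral_map, hmn.integral_map]
      simpa using h (-w) (by rwa [abs_neg])
    have hslit : ((-t : ℝ) : ℂ) - ((-c : ℝ) : ℂ) ∈ slitPlane := by
      refine Or.inl ?_
      simp only [sub_re, ofReal_re]; linarith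
    have hne := integral_cpow_ne_zero (hsupp ν hν) ha0 ha1 hslit
    have hfor := integral_cpow_relation (hsupp μ hμ) (hsupp ν hν) hδ hrel hslit
    rw [hmn.integral_map] at hne
    rw [hmn.integral_map, hmn.integral_map, hmn.integral_map] at hfor
    have hpow : ∀ s : ℂ, ∫ x : ℝ, ((t : ℂ) - (x : ℂ)) ^ s ∂ν =
        (∫ x : ℝ, (((-t : ℝ) : ℂ) - ((-x : ℝ) : ℂ)) ^ s ∂ν) * exp (Real.pi * I * s) := by
      intro s
      rw [← integral_mul_const]
      refine integral_congr_ae ?_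
      filter_upwards [hν] with x hx
      have := ofReal_cpow_of_nonpos (x := t - x) (by linarith [hx.1]) s
      push_cast at this ⊢
      rw [this]
      congr 2
      ring
    have hexp : exp (Real.pi * I * ((a : ℂ) - 1)) = -exp (Real.pi * I * a) := by
      rw [mul_sub, mul_one, exp_sub, exp_pi_mul_I, div_neg, div_one]
    have hs : stieltjesTransform μ t =
        ∫ x : ℝ, (((-t : ℝ) : ℂ) - ((-x : ℝ) : ℂ)) ^ (-1 : ℂ) ∂μ := by
      rw [stieltjesTransform_eq]
      congr 1; ext x
      rw [cpow_neg_one, one_div]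
      congr 1
      push_cast; ring
    rw [hpow, hpow, hexp, hs, ← hfor]
    have he := exp_ne_zero (Real.pi * I * a)
    refine ⟨mul_ne_zero hne he, ?_⟩
    field_simp

/-! ### The limit law of self-normalized weighted sums -/

theorem exists_boundedContinuous_eqOn {g : ℝ → ℝ} {c d : ℝ} (hcd : c ≤ d)
    (hg : ContinuousOn g (Set.Icc c d)) : ∃ f : ℝ →ᵇ ℝ, ∀ x ∈ Set.Icc c d, f x = g x := by
  refine ⟨(BoundedContinuousFunction.mkOfCompact
    ⟨(Set.Icc c d).domRestrict g, continuousOn_iff_continuous_domRestrict.1 hg⟩).compContinuous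
      ⟨Set.projIcc c d hcd, continuous_projIcc⟩, fun x hx => ?_⟩
  simp [Set.projIcc_of_mem hcd hx]

/-- The distance to the interval `[c, d]`, cut off at `1`. -/
def cutoffDist (c d : ℝ) : ℝ →ᵇ ℝ :=
  BoundedContinuousFunction.ofNormedAddCommGroup
    (fun x => min 1 |x - max c (min d x)|) (by fun_prop) 1 (fun x => by
      rw [Real.norm_eq_abs, abs_of_nonneg (le_min zero_le_one (abs_nonneg _))]
      exact min_le_left _ _)

theorem cutoffDist_apply (c d x : ℝ) : cutoffDist c d x = min 1 |x - max c (min d x)| := rfl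

theorem cutoffDist_nonneg (c d x : ℝ) : 0 ≤ cutoffDist c d x :=
  le_min zero_le_one (abs_nonneg _)

theorem cutoffDist_of_mem {c d x : ℝ} (hx : x ∈ Set.Icc c d) : cutoffDist c d x = 0 := by
  simp [cutoffDist_apply, min_eq_right hx.2, max_eq_right hx.1]

theorem mem_Icc_of_cutoffDist_eq_zero {c d x : ℝ} (hcd : c ≤ d) (hx : cutoffDist c d x = 0) :
    x ∈ Set.Icc c d := by
  have h : |x - max c (min d x)| = 0 := by
    rw [cutoffDist_apply] at hx
    rcases min_choice 1 |x - max c (min d x)| with h | h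
    · rw [h] at hx; exact absurd hx one_ne_zero
    · rw [← h, hx]
  rw [sub_eq_zero.1 (abs_eq_zero.1 h)]
  exact ⟨le_max_left _ _, max_le hcd (min_le_left _ _)⟩

theorem ae_mem_Icc_of_integral_cutoffDist_eq_zero {ρ : Measure ℝ} [IsFiniteMeasure ρ] {c d : ℝ}
    (hcd : c ≤ d) (h : ∫ x, cutoffDist c d x ∂ρ = 0) : ∀ᵐ x ∂ρ, x ∈ Set.Icc c d := by
  have := (integral_eq_zero_iff_of_nonneg (fun x => cutoffDist_nonneg c d x)
    ((cutoffDist c d).integrable ρ)).1 h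
  filter_upwards [this] with x hx
  exact mem_Icc_of_cutoffDist_eq_zero hcd hx

/-- The averages over the array `b` of every bounded continuous function converge to its integral
against `ν`. -/
def ArrayTendsto (b : (n : ℕ) → Fin n → ℝ) (ν : Measure ℝ) : Prop :=
  ∀ f : ℝ →ᵇ ℝ, Tendsto (fun n : ℕ => (n : ℝ)⁻¹ * ∑ i, f (b n i)) atTop (𝓝 (∫ x, f x ∂ν))

theorem ArrayTendsto.tendsto_of_continuousOn {b : (n : ℕ) → Fin n → ℝ} {ν : Measure ℝ}
    (h : ArrayTendsto b ν) {c d : ℝ} (hcd : c ≤ d)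
    (hb : ∀ᶠ n in atTop, ∀ i, b n i ∈ Set.Icc c d) (hν : ∀ᵐ x ∂ν, x ∈ Set.Icc c d) {g : ℝ → ℝ}
    (hg : ContinuousOn g (Set.Icc c d)) :
    Tendsto (fun n : ℕ => (n : ℝ)⁻¹ * ∑ i, g (b n i)) atTop (𝓝 (∫ x, g x ∂ν)) := by
  obtain ⟨f, hf⟩ := exists_boundedContinuous_eqOn hcd hg
  have e : ∫ x, f x ∂ν = ∫ x, g x ∂ν := integral_congr_ae (hν.mono hf)
  rw [← e]
  refine (h f).congr' ?_
  filter_upwards [hb] with n hn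
  rw [Finset.sum_congr rfl fun i _ => hf _ (hn i)]

theorem ArrayTendsto.ae_mem_Icc {b : (n : ℕ) → Fin n → ℝ} {ν : Measure ℝ} [IsFiniteMeasure ν]
    (h : ArrayTendsto b ν) {c d : ℝ} (hcd : c ≤ d)
    (hb : ∀ᶠ n in atTop, ∀ i, b n i ∈ Set.Icc c d) : ∀ᵐ x ∂ν, x ∈ Set.Icc c d := by
  refine ae_mem_Icc_of_integral_cutoffDist_eq_zero hcd (tendsto_nhds_unique (h _) ?_)
  refine tendsto_const_nhds.congr' ?_
  filter_upwards [hb] with n hn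
  rw [Finset.sum_congr rfl fun i _ => cutoffDist_of_mem (hn i)]
  simp

/-- Clamping to an interval that carries the limit does not change the limit. -/
theorem ArrayTendsto.clamp {b : (n : ℕ) → Fin n → ℝ} {ν : Measure ℝ} (h : ArrayTendsto b ν)
    {c d : ℝ} (hν : ∀ᵐ x ∂ν, x ∈ Set.Icc c d) :
    ArrayTendsto (fun n i => max c (min d (b n i))) ν := by
  intro f
  have := h (f.compContinuous ⟨fun x => max c (min d x), by fun_prop⟩)
  simp only [BoundedContinuousFunction.compContinuous_apply, ContinuousMap.coe_mk] at this
  convert! this using 2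
  refine integral_congr_ae ?_
  filter_upwards [hν] with x hx
  rw [min_eq_right hx.2, max_eq_right hx.1]

/-- The self-normalized weighted sum `∑ b W / ∑ W`, equal to `0` where `∑ W = 0`. -/
def weightedMean {Ω : Type*} (W : ℕ → Ω → ℝ) {n : ℕ} (b : Fin n → ℝ) (ω : Ω) : ℝ :=
  (∑ i, b i * W i ω) / ∑ i : Fin n, W i ω

section WeightedMean

variable {Ω : Type*} [MeasurableSpace Ω] {P : Measure Ω} {W : ℕ → Ω → ℝ}

theorem measurable_weightedMean (hW : ∀ j, Measurable (W j)) {n : ℕ} (b : Fin n → ℝ) :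
    Measurable (weightedMean W b) := by
  unfold weightedMean
  fun_prop

omit [MeasurableSpace Ω] in
theorem weightedMean_mem_Icc (hnn : ∀ j ω, 0 ≤ W j ω) {n : ℕ} {b : Fin n → ℝ} {c d : ℝ}
    (hb : ∀ i, b i ∈ Set.Icc c d) {ω : Ω} (hω : ∑ i : Fin n, W i ω ≠ 0) :
    weightedMean W b ω ∈ Set.Icc c d := by
  have hpos : 0 < ∑ i : Fin n, W i ω :=
    lt_of_le_of_ne (Finset.sum_nonneg fun i _ => hnn i ω) (Ne.symm hω)
  constructor
  · rw [weightedMean, le_div_iff₀ hpos, Finset.mul_sum]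
    exact Finset.sum_le_sum fun i _ => mul_le_mul_of_nonneg_right (hb i).1 (hnn i ω)
  · rw [weightedMean, div_le_iff₀ hpos, Finset.mul_sum]
    exact Finset.sum_le_sum fun i _ => mul_le_mul_of_nonneg_right (hb i).2 (hnn i ω)

omit [MeasurableSpace Ω] in
theorem abs_weightedMean_le (hnn : ∀ j ω, 0 ≤ W j ω) {n : ℕ} {b : Fin n → ℝ} {K : ℝ}
    (hK : 0 ≤ K) (hb : ∀ i, |b i| ≤ K) (ω : Ω) : |weightedMean W b ω| ≤ K := by
  by_cases h : ∑ i : Fin n, W i ω = 0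
  · rw [weightedMean, h, div_zero, abs_zero]; exact hK
  · exact abs_le.2 (weightedMean_mem_Icc hnn (fun i => abs_le.1 (hb i)) h)

variable [IsProbabilityMeasure P]

/-- The law of the self-normalized weighted sum. -/
def weightedMeanLaw (P : Measure Ω) [IsProbabilityMeasure P] (hW : ∀ j, Measurable (W j))
    {n : ℕ} (b : Fin n → ℝ) : ProbabilityMeasure ℝ :=
  ⟨P.map (weightedMean W b),
    Measure.isProbabilityMeasure_map (measurable_weightedMean hW b).aemeasurable⟩

theorem integral_weightedMeanLaw (hW : ∀ j, Measurable (W j)) {n : ℕ} (b : Fin n → ℝ)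
    (f : ℝ →ᵇ ℝ) :
    ∫ x, f x ∂(weightedMeanLaw P hW b : Measure ℝ) = ∫ ω, f (weightedMean W b ω) ∂P :=
  integral_map (measurable_weightedMean hW b).aemeasurable
    f.continuous.measurable.aestronglyMeasurable

/-- A sequence of independent, identically distributed, nonnegative variables whose tail is
regularly varying with index `-a`. -/
structure IsHeavyTailedSequence (P : Measure Ω) (W : ℕ → Ω → ℝ) (a : ℝ) : Prop where
  meas : ∀ j, Measurable (W j)
  nonneg : ∀ j ω, 0 ≤ W j ω
  indep : iIndepFun W P
  identDistrib : ∀ j, IdentDistrib (W j) (W 0) P P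
  tail : IsRegularTail (fun x => P.real {ω | x < W 0 ω}) a

variable {a : ℝ}

/-- `1 - w Q` is again a self-normalized weighted sum, with the positive weights `1 - w b`. -/
theorem tendsto_integral_inv_one_sub_mul_weightedMean (hS : IsHeavyTailedSequence P W a)
    (ha0 : 0 < a) (ha1 : a < 1) {b : (n : ℕ) → Fin n → ℝ} {ν : Measure ℝ} [IsProbabilityMeasure ν]
    (hbν : ArrayTendsto b ν) {K w : ℝ} (hK : 0 ≤ K)
    (hb : ∀ᶠ n in atTop, ∀ i, |b n i| ≤ K) (hν : ∀ᵐ x ∂ν, |x| ≤ K) (hw : |w| * K < 1) :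
    0 < ∫ x, (1 - w * x) ^ a ∂ν ∧
    Tendsto (fun n => ∫ ω, (1 - w * weightedMean W (b n) ω)⁻¹ ∂P) atTop
      (𝓝 ((∫ x, (1 - w * x) ^ (a - 1) ∂ν) / ∫ x, (1 - w * x) ^ a ∂ν)) := by
  have hmem : ∀ x, |x| ≤ K → 1 - w * x ∈ Set.Icc (1 - |w| * K) (1 + |w| * K) := by
    intro x hx
    have h1 : |w * x| ≤ |w| * K := by
      rw [abs_mul]; exact mul_le_mul_of_nonneg_left hx (abs_nonneg w)
    have h2 := abs_le.1 h1
    constructor <;> linarith [h2.1, h2.2]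
  have hb₀ : 0 < 1 - |w| * K := by linarith
  have hcont : ∀ s : ℝ, ContinuousOn (fun x => (1 - w * x) ^ s) (Set.Icc (-K) K) := by
    intro s
    refine ContinuousOn.rpow_const (by fun_prop) fun x hx => Or.inl ?_
    exact (hb₀.trans_le (hmem x (abs_le.2 hx)).1).ne'
  have hlim : ∀ s : ℝ, Tendsto (fun n : ℕ => (n : ℝ)⁻¹ * ∑ i, (1 - w * b n i) ^ s) atTop
      (𝓝 (∫ x, (1 - w * x) ^ s ∂ν)) := fun s =>
    hbν.tendsto_of_continuousOn (neg_le_self hK) (hb.mono fun n hn i => abs_le.1 (hn i))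
      (hν.mono fun x hx => abs_le.1 hx) (hcont s)
  have hpos : 0 < ∫ x, (1 - w * x) ^ a ∂ν := by
    obtain ⟨f, hf⟩ := exists_boundedContinuous_eqOn (neg_le_self hK) (hcont a)
    refine integral_pos_of_ae_pos ((f.integrable ν).congr
      (hν.mono fun x hx => hf x (abs_le.1 hx))) ?_
    filter_upwards [hν] with x hx
    exact Real.rpow_pos_of_pos (hb₀.trans_le (hmem x hx).1) _
  refine ⟨hpos, ?_⟩
  have h1 := tendsto_integral_sum_div_sum ha0 ha1 hS.meas hS.nonneg hS.indep hS.identDistrib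
    hS.tail (fun n i => 1 - w * b n i) hb₀ (hb.mono fun n hn i => hmem _ (hn i)) (hlim (a - 1))
    (hlim a) (integral_nonneg_of_ae (by
      filter_upwards [hν] with x hx
      exact Real.rpow_nonneg (hb₀.le.trans (hmem x hx).1) _)) hpos
  -- on `∑ W = 0` the left side is `1`, while the quotient of the two sums is `0`
  have hz := tendsto_measure_sum_eq_zero hS.meas hS.nonneg hS.indep hS.identDistrib (hS.tail.pos 0)
  have h2 := h1.add hz
  rw [add_zero] at h2
  refine h2.congr' ?_
  filter_upwards [hb] with n hn
  have hWm := hS.meas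
  have hm : MeasurableSet {ω | ∑ i : Fin n, W i ω = 0} :=
    measurableSet_eq_fun (Finset.measurable_sum _ fun i _ => hWm i) measurable_const
  have hT : ∀ ω, ∑ i : Fin n, (1 - w * b n i) * W i ω =
      ∑ i : Fin n, W i ω - w * ∑ i : Fin n, b n i * W i ω := by
    intro ω
    rw [Finset.mul_sum, ← Finset.sum_sub_distrib]
    exact Finset.sum_congr rfl fun i _ => by ring
  have key : ∀ ω, (1 - w * weightedMean W (b n) ω)⁻¹ =
      (∑ i : Fin n, W i ω) / (∑ i : Fin n, (1 - w * b n i) * W i ω) +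
        {ω | ∑ i : Fin n, W i ω = 0}.indicator (fun _ => (1 : ℝ)) ω := by
    intro ω
    by_cases h : ∑ i : Fin n, W i ω = 0
    · rw [Set.indicator_of_mem (by exact h), weightedMean, h]
      simp
    · rw [Set.indicator_of_notMem (by exact h), add_zero, hT, weightedMean]
      field_simp
  have hbd : ∀ ω, ‖(1 - w * weightedMean W (b n) ω)⁻¹‖ ≤ (1 - |w| * K)⁻¹ := by
    intro ω
    have := (hmem _ (abs_weightedMean_le hS.nonneg hK hn ω)).1
    rw [norm_inv, Real.norm_eq_abs, abs_of_pos (hb₀.trans_le this)]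
    exact inv_anti₀ hb₀ this
  have hI : Integrable (fun ω => (1 - w * weightedMean W (b n) ω)⁻¹) P :=
    Integrable.of_bound (((measurable_weightedMean hWm (b n)).const_mul w).const_sub
      1).inv.aestronglyMeasurable _ (Eventually.of_forall hbd)
  have hI1 : Integrable ({ω | ∑ i : Fin n, W i ω = 0}.indicator (fun _ => (1 : ℝ))) P :=
    (integrable_const 1).indicator hm
  have e : ∀ ω, (∑ i : Fin n, W i ω) / (∑ i : Fin n, (1 - w * b n i) * W i ω) =
      (1 - w * weightedMean W (b n) ω)⁻¹ -
        {ω | ∑ i : Fin n, W i ω = 0}.indicator (fun _ => (1 : ℝ)) ω := fun ω => by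
    rw [key]; ring
  simp_rw [e]
  rw [integral_sub hI hI1, integral_indicator_const _ hm, smul_eq_mul, mul_one, sub_add_cancel]

/-- The relation between the generalized Stieltjes transforms of `μ` and `ν` that characterizes
the limit law, for small real `w = 1 / z`. -/
def TransformRelation (a δ : ℝ) (μ ν : Measure ℝ) : Prop :=
  ∀ w : ℝ, |w| < δ → (∫ x, (1 - w * x)⁻¹ ∂μ) * (∫ x, (1 - w * x) ^ a ∂ν) =
    ∫ x, (1 - w * x) ^ (a - 1) ∂ν

theorem abs_mul_lt_one_of_lt_inv {K w : ℝ} (hK : 0 ≤ K) (hw : |w| < (K + 1)⁻¹) : |w| * K < 1 := by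
  have h1 : 0 < K + 1 := by linarith
  rw [← one_div, lt_div_iff₀ h1] at hw
  linarith [abs_nonneg w]

/-- Every cluster point of the laws of the self-normalized sums satisfies the relation. -/
theorem transformRelation_of_mapClusterPt (hS : IsHeavyTailedSequence P W a)
    (ha0 : 0 < a) (ha1 : a < 1) {b : (n : ℕ) → Fin n → ℝ} {ν : Measure ℝ} [IsProbabilityMeasure ν]
    (hbν : ArrayTendsto b ν) {K : ℝ} (hK : 0 ≤ K)
    (hb : ∀ᶠ n in atTop, ∀ i, |b n i| ≤ K) {μ : ProbabilityMeasure ℝ}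
    (hμK : ∀ᵐ x ∂(μ : Measure ℝ), |x| ≤ K)
    (hμ : MapClusterPt μ atTop fun n => weightedMeanLaw P hS.meas (b n)) :
    TransformRelation a (K + 1)⁻¹ μ ν := by
  intro w hw
  have hwK := abs_mul_lt_one_of_lt_inv hK hw
  have hν : ∀ᵐ x ∂ν, |x| ≤ K := (hbν.ae_mem_Icc (neg_le_self hK)
    (hb.mono fun n hn i => abs_le.1 (hn i))).mono fun x hx => abs_le.2 hx
  obtain ⟨hpos, hlim⟩ := tendsto_integral_inv_one_sub_mul_weightedMean hS ha0 ha1 hbν hK hb hν hwK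
  have hcont : ContinuousOn (fun x => (1 - w * x)⁻¹) (Set.Icc (-K) K) := by
    refine ContinuousOn.inv₀ (by fun_prop) fun x hx => ?_
    have h1 : w * x ≤ |w| * K := (le_abs_self _).trans (by
      rw [abs_mul]; exact mul_le_mul_of_nonneg_left (abs_le.2 hx) (abs_nonneg w))
    linarith
  obtain ⟨f, hf⟩ := exists_boundedContinuous_eqOn (neg_le_self hK) hcont
  have h1 : MapClusterPt (∫ x, f x ∂(μ : Measure ℝ)) atTop
      fun n => ∫ x, f x ∂(weightedMeanLaw P hS.meas (b n) : Measure ℝ) :=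
    hμ.continuousAt_comp
      (ProbabilityMeasure.continuous_integral_boundedContinuousFunction f).continuousAt
  have h2 : Tendsto (fun n => ∫ x, f x ∂(weightedMeanLaw P hS.meas (b n) : Measure ℝ)) atTop
      (𝓝 ((∫ x, (1 - w * x) ^ (a - 1) ∂ν) / ∫ x, (1 - w * x) ^ a ∂ν)) := by
    refine hlim.congr' ?_
    filter_upwards [hb] with n hn
    rw [integral_weightedMeanLaw]
    congr 1; ext ω
    exact (hf _ (abs_le.1 (abs_weightedMean_le hS.nonneg hK hn ω))).symm
  have h3 : ∫ x, f x ∂(μ : Measure ℝ) =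
      (∫ x, (1 - w * x) ^ (a - 1) ∂ν) / ∫ x, (1 - w * x) ^ a ∂ν :=
    eq_of_nhds_neBot (NeBot.mono h1 (inf_le_inf_left _ h2))
  have h4 : ∫ x, (1 - w * x)⁻¹ ∂(μ : Measure ℝ) = ∫ x, f x ∂(μ : Measure ℝ) :=
    integral_congr_ae (hμK.mono fun x hx => (hf x (abs_le.1 hx)).symm)
  rw [h4, h3, div_mul_cancel₀ _ hpos.ne']

theorem isCompact_setOf_ae_abs_le (K : ℝ) :
    IsCompact {μ : ProbabilityMeasure ℝ | ∀ᵐ x ∂(μ : Measure ℝ), |x| ≤ K} := by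
  have h := isCompact_setOfPred_probabilityMeasure_mass_eq_compl_isCompact_le (E := ℝ)
    (u := fun _ => 0) (K := fun _ => Set.Icc (-K) K) tendsto_const_nhds
    (fun _ => isCompact_Icc) (Or.inl inferInstance)
  convert! h using 1
  ext μ
  have e : {x : ℝ | ¬ |x| ≤ K} = (Set.Icc (-K) K)ᶜ := by
    ext x; simp [abs_le]
  change (μ : Measure ℝ) {x : ℝ | ¬ |x| ≤ K} = 0 ↔ ∀ _ : ℕ, μ (Set.Icc (-K) K)ᶜ ≤ 0
  rw [e]
  simp [ProbabilityMeasure.null_iff_toMeasure_null]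

theorem weightedMeanLaw_mem (hS : IsHeavyTailedSequence P W a) {b : (n : ℕ) → Fin n → ℝ} {K : ℝ}
    (hK : 0 ≤ K) (hb : ∀ᶠ n in atTop, ∀ i, |b n i| ≤ K) :
    ∀ᶠ n in atTop, weightedMeanLaw P hS.meas (b n) ∈
      {μ : ProbabilityMeasure ℝ | ∀ᵐ x ∂(μ : Measure ℝ), |x| ≤ K} := by
  filter_upwards [hb] with n hn
  change ∀ᵐ x ∂(P.map (weightedMean W (b n))), |x| ≤ K
  rw [ae_map_iff (measurable_weightedMean hS.meas (b n)).aemeasurable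
    (measurableSet_le continuous_abs.measurable measurable_const)]
  exact Eventually.of_forall (abs_weightedMean_le hS.nonneg hK hn)

theorem eq_of_transformRelation {α : ℝ} (hα0 : 0 < α) (hα2 : α < 2) {μ μ' ν : Measure ℝ}
    [IsProbabilityMeasure μ] [IsProbabilityMeasure μ'] [IsProbabilityMeasure ν] {K δ δ' : ℝ}
    (hK : 0 ≤ K) (hμ : ∀ᵐ x ∂μ, |x| ≤ K) (hμ' : ∀ᵐ x ∂μ', |x| ≤ K) (hν : ∀ᵐ x ∂ν, |x| ≤ K)
    (hδ : 0 < δ) (hδ' : 0 < δ') (h : TransformRelation (α / 2) δ μ ν)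
    (h' : TransformRelation (α / 2) δ' μ' ν) : μ' = μ := by
  refine eq_of_forall_integral_pow_eq hK hμ
    (fun l _ => integrable_pow_of_ae_abs_le hμ' l) fun l hl => ?_
  rw [integral_pow_eq_limitMoment hα0 hα2 hK hμ hν hδ h hl,
    integral_pow_eq_limitMoment hα0 hα2 hK hμ' hν hδ' h' hl]

/-- Existence of the limit law. Clamping the weights to `[c, d]` does not change their limiting
distribution and produces a law that lives on `[c, d]`. -/
theorem exists_transformRelation (hS : IsHeavyTailedSequence P W a)
    (ha0 : 0 < a) (ha1 : a < 1) {b : (n : ℕ) → Fin n → ℝ} {ν : Measure ℝ} [IsProbabilityMeasure ν]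
    (hbν : ArrayTendsto b ν) {c d : ℝ} (hcd : c ≤ d) (hν : ∀ᵐ x ∂ν, x ∈ Set.Icc c d) :
    ∃ (μ : ProbabilityMeasure ℝ) (δ : ℝ), 0 < δ ∧ (∀ᵐ x ∂(μ : Measure ℝ), x ∈ Set.Icc c d) ∧
      TransformRelation a δ μ ν := by
  set b' : (n : ℕ) → Fin n → ℝ := fun n i => max c (min d (b n i)) with hb'
  have hb'mem : ∀ n i, b' n i ∈ Set.Icc c d := fun n i =>
    ⟨le_max_left _ _, max_le hcd (min_le_left _ _)⟩
  set K := max |c| |d| with hKdef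
  have hK : 0 ≤ K := (abs_nonneg c).trans (le_max_left _ _)
  have habs : ∀ᶠ n in atTop, ∀ i, |b' n i| ≤ K :=
    Eventually.of_forall fun n i => abs_le_max_abs_abs (hb'mem n i).1 (hb'mem n i).2
  obtain ⟨μ, hμK, hμ⟩ := (isCompact_setOf_ae_abs_le K).exists_mapClusterPt_of_frequently
    (weightedMeanLaw_mem hS hK habs).frequently
  refine ⟨μ, (K + 1)⁻¹, by positivity, ?_,
    transformRelation_of_mapClusterPt hS ha0 ha1 (hbν.clamp hν) hK habs hμK hμ⟩
  refine ae_mem_Icc_of_integral_cutoffDist_eq_zero hcd ?_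
  have h1 : MapClusterPt (∫ x, cutoffDist c d x ∂(μ : Measure ℝ)) atTop
      fun n => ∫ x, cutoffDist c d x ∂(weightedMeanLaw P hS.meas (b' n) : Measure ℝ) :=
    hμ.continuousAt_comp (ProbabilityMeasure.continuous_integral_boundedContinuousFunction
      (cutoffDist c d)).continuousAt
  have h2 : Tendsto (fun n => ∫ x, cutoffDist c d x ∂(weightedMeanLaw P hS.meas (b' n) :
      Measure ℝ)) atTop (𝓝 0) := by
    refine squeeze_zero (fun n => integral_nonneg fun x => cutoffDist_nonneg c d x) (fun n => ?_)
      (tendsto_measure_sum_eq_zero hS.meas hS.nonneg hS.indep hS.identDistrib (hS.tail.pos 0))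
    have hWm := hS.meas
    have hm : MeasurableSet {ω | ∑ i : Fin n, W i ω = 0} :=
      measurableSet_eq_fun (Finset.measurable_sum _ fun i _ => hWm i) measurable_const
    rw [integral_weightedMeanLaw, ← integral_indicator_one hm]
    refine integral_mono_of_nonneg (Eventually.of_forall fun ω => cutoffDist_nonneg c d _)
      ((integrable_const 1).indicator hm) (Eventually.of_forall fun ω => ?_)
    by_cases h : ∑ i : Fin n, W i ω = 0
    · rw [Set.indicator_of_mem (by exact h)]
      exact min_le_left _ _
    · rw [Set.indicator_of_notMem (by exact h)]
      exact (cutoffDist_of_mem (weightedMean_mem_Icc hS.nonneg (hb'mem n) h)).le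
  exact eq_of_nhds_neBot (NeBot.mono h1 (inf_le_inf_left _ h2))

/-- The laws of the self-normalized sums stay in a compact set of measures, and the relation
identifies their only possible cluster point. -/
theorem tendsto_weightedMeanLaw {α : ℝ} (hα0 : 0 < α) (hα2 : α < 2)
    (hS : IsHeavyTailedSequence P W (α / 2)) {b : (n : ℕ) → Fin n → ℝ} {ν : Measure ℝ}
    [IsProbabilityMeasure ν] (hbν : ArrayTendsto b ν) {K δ : ℝ} (hK : 0 ≤ K)
    (hb : ∀ᶠ n in atTop, ∀ i, |b n i| ≤ K) {μ : ProbabilityMeasure ℝ}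
    (hμK : ∀ᵐ x ∂(μ : Measure ℝ), |x| ≤ K) (hδ : 0 < δ)
    (hμ : TransformRelation (α / 2) δ μ ν) :
    Tendsto (fun n => weightedMeanLaw P hS.meas (b n)) atTop (𝓝 μ) := by
  have hν : ∀ᵐ x ∂ν, |x| ≤ K := (hbν.ae_mem_Icc (neg_le_self hK)
    (hb.mono fun n hn i => abs_le.1 (hn i))).mono fun x hx => abs_le.2 hx
  refine (isCompact_setOf_ae_abs_le K).tendsto_nhds_of_unique_mapClusterPt
    (weightedMeanLaw_mem hS hK hb) fun μ' hμ'K hμ' => ?_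
  exact Subtype.ext (eq_of_transformRelation (μ := (μ : Measure ℝ)) (μ' := (μ' : Measure ℝ)) hα0 hα2 hK hμK hμ'K hν hδ (by positivity) hμ
    (transformRelation_of_mapClusterPt hS (by linarith) (by linarith) hbν hK hb hμ'K hμ'))

end WeightedMean

/-! ### The quadratic form -/

section Model

variable {Ω : Type*} [MeasurableSpace Ω] {P : Measure Ω} [IsProbabilityMeasure P]

/-- The squares of independent copies of a variable with tail index `α` have tail index `α / 2`. -/
theorem isHeavyTailedSequence_sq {α : ℝ} {ξ : Ω → ℝ} (hξ : HasRegularlyVaryingTail P ξ α)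
    {X : ℕ → Ω → ℝ} (hX : ∀ j, Measurable (X j)) (hind : iIndepFun X P)
    (hid : ∀ j, IdentDistrib (X j) ξ P P) :
    IsHeavyTailedSequence P (fun j ω => X j ω ^ 2) (α / 2) := by
  obtain ⟨L, ⟨hLpos, hL⟩, htail⟩ := hξ
  have hm : Measurable fun x : ℝ => x ^ 2 := by fun_prop
  set F : ℝ → ℝ := fun x => P.real {ω | x < X 0 ω ^ 2} with hFdef
  have hF : ∀ x, 0 < x → F x = √x ^ (-α) * L √x := by
    intro x hx
    rw [← htail _ (Real.sqrt_pos.2 hx)]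
    have h1 : {ω | x < X 0 ω ^ 2} = X 0 ⁻¹' {y | √x < |y|} := by
      ext ω
      change x < X 0 ω ^ 2 ↔ √x < |X 0 ω|
      rw [← Real.sqrt_sq_eq_abs, Real.sqrt_lt_sqrt_iff hx.le]
    have hms : MeasurableSet {y : ℝ | √x < |y|} :=
      measurableSet_lt measurable_const continuous_abs.measurable
    rw [hFdef]
    simp only [h1, measureReal_def]
    rw [(hid 0).measure_mem_eq hms]
    rfl
  have hFpos : ∀ x, 0 < x → 0 < F x := by
    intro x hx
    rw [hF x hx]
    exact mul_pos (Real.rpow_pos_of_pos (Real.sqrt_pos.2 hx) _) (hLpos _ (Real.sqrt_pos.2 hx))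
  have hanti : Antitone F := fun x y hxy =>
    measureReal_mono fun ω (hω : y < X 0 ω ^ 2) => lt_of_le_of_lt hxy hω
  refine ⟨fun j => hm.comp (hX j), fun j ω => sq_nonneg _, hind.comp (fun _ x => x ^ 2) fun _ => hm,
    fun j => ((hid j).trans (hid 0).symm).comp hm, ⟨hanti, fun x => ?_, fun x => measureReal_le_one,
      fun t ht => ?_⟩⟩
  · exact (hFpos (max x 1) (by positivity)).trans_le (hanti (le_max_left _ _))
  · have h1 := ((hL √t (Real.sqrt_pos.2 ht)).comp Real.tendsto_sqrt_atTop).const_mul (√t ^ (-α))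
    have e : √t ^ (-α) * 1 = t ^ (-(α / 2)) := by
      rw [mul_one, Real.sqrt_eq_rpow, ← Real.rpow_mul ht.le]
      congr 1; ring
    rw [e] at h1
    refine h1.congr' ?_
    filter_upwards [eventually_gt_atTop 0] with x hx
    have hsx := Real.sqrt_pos.2 hx
    change √t ^ (-α) * (L (√t * √x) / L √x) = F (t * x) / F x
    rw [hF x hx, hF (t * x) (mul_pos ht hx), Real.sqrt_mul ht.le,
      Real.mul_rpow (Real.sqrt_nonneg _) hsx.le]
    have h2 := (Real.rpow_pos_of_pos hsx (-α)).ne'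
    have h3 := (hLpos _ hsx).ne'
    field_simp

theorem diagQuadForm_eq_sum {n : ℕ} (y : Fin n → ℝ) (B : Matrix (Fin n) (Fin n) ℂ) :
    diagQuadForm y B = ∑ i, (B i i).re * y i ^ 2 := by
  rw [diagQuadForm, quadForm_diagonal, Complex.re_sum]
  refine Finset.sum_congr rfl fun i _ => ?_
  rw [Matrix.diag_apply, ← Complex.ofReal_pow, Complex.re_mul_ofReal]

omit [MeasurableSpace Ω] in
theorem diagQuadForm_selfNormalized (X : ℕ → Ω → ℝ) {n : ℕ} (B : Matrix (Fin n) (Fin n) ℂ)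
    (ω : Ω) : diagQuadForm (selfNormalized X n ω) B =
      weightedMean (fun j ω => X j ω ^ 2) (fun i => (B i i).re) ω := by
  rw [diagQuadForm_eq_sum, weightedMean, Finset.sum_div]
  refine Finset.sum_congr rfl fun i _ => ?_
  rw [selfNormalized, div_pow, Real.sq_sqrt (Finset.sum_nonneg fun j _ => sq_nonneg _), mul_div]

theorem measurable_selfNormalized {X : ℕ → Ω → ℝ} (hX : ∀ j, Measurable (X j)) (n : ℕ) :
    Measurable fun ω => selfNormalized X n ω := by
  refine measurable_pi_lambda _ fun i => ?_
  unfold selfNormalized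
  fun_prop

theorem measurable_sum_re_mul_sq (n : ℕ) :
    Measurable fun p : (Fin n → Fin n → ℂ) × (Fin n → ℝ) => ∑ i, (p.1 i i).re * p.2 i ^ 2 := by
  refine Finset.measurable_sum _ fun i _ => ?_
  have h1 : Measurable fun p : (Fin n → Fin n → ℂ) × (Fin n → ℝ) => p.1 i i := by fun_prop
  have h2 : Measurable fun p : (Fin n → Fin n → ℂ) × (Fin n → ℝ) => p.2 i := by fun_prop
  exact (Complex.measurable_re.comp h1).mul (h2.pow_const 2)

/-- Convergence in distribution may be checked conditionally on one of two independent variables. -/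
theorem tendsto_integral_of_indepFun {E G : ℕ → Type*} [∀ n, MeasurableSpace (E n)]
    [∀ n, MeasurableSpace (G n)] {U : (n : ℕ) → Ω → E n} {V : (n : ℕ) → Ω → G n}
    (hU : ∀ n, Measurable (U n)) (hV : ∀ n, Measurable (V n))
    (hUV : ∀ n, IndepFun (U n) (V n) P) {q : (n : ℕ) → E n × G n → ℝ} (hq : ∀ n, Measurable (q n))
    (f : ℝ →ᵇ ℝ) {m : ℝ}
    (h : ∀ᵐ ω' ∂P, Tendsto (fun n => ∫ ω, f (q n (U n ω', V n ω)) ∂P) atTop (𝓝 m)) :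
    Tendsto (fun n => ∫ ω, f (q n (U n ω, V n ω)) ∂P) atTop (𝓝 m) := by
  have hfq : ∀ n, Measurable fun p => f (q n p) := fun n => f.continuous.measurable.comp (hq n)
  have e : ∀ n, ∫ ω, f (q n (U n ω, V n ω)) ∂P = ∫ ω', ∫ ω, f (q n (U n ω', V n ω)) ∂P ∂P := by
    intro n
    have := Measure.isProbabilityMeasure_map (μ := P) (hU n).aemeasurable
    have := Measure.isProbabilityMeasure_map (μ := P) (hV n).aemeasurable
    have hprod := (indepFun_iff_map_prod_eq_prod_map_map (hU n).aemeasurable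
      (hV n).aemeasurable).1 (hUV n)
    have h1 : ∫ ω, f (q n (U n ω, V n ω)) ∂P =
        ∫ p, f (q n p) ∂(P.map fun ω => (U n ω, V n ω)) :=
      (integral_map ((hU n).prodMk (hV n)).aemeasurable (hfq n).aestronglyMeasurable).symm
    rw [h1, hprod, integral_prod _ (Integrable.of_bound (hfq n).aestronglyMeasurable ‖f‖
      (Eventually.of_forall fun p => f.norm_coe_le_norm _)),
      integral_map (hU n).aemeasurable
        ((hfq n).stronglyMeasurable.integral_prod_right').aestronglyMeasurable]
    congr 1; ext ω'
    exact integral_map (hV n).aemeasurable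
      ((hfq n).comp measurable_prodMk_left).aestronglyMeasurable
  simp_rw [e]
  have hm : ∫ _, m ∂P = m := by simp
  rw [← hm]
  refine tendsto_integral_of_dominated_convergence (fun _ => ‖f‖) (fun n => ?_)
    (integrable_const _) (fun n => Eventually.of_forall fun ω' => ?_) h
  · have : Measurable fun p : Ω × Ω => f (q n (U n p.1, V n p.2)) :=
      (hfq n).comp (((hU n).comp measurable_fst).prodMk ((hV n).comp measurable_snd))
    exact (this.stronglyMeasurable.integral_prod_right').aestronglyMeasurable
  · have := norm_integral_le_of_norm_le_const (μ := P) (f := fun ω => f (q n (U n ω', V n ω)))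
      (C := ‖f‖) (Eventually.of_forall fun ω => f.norm_coe_le_norm _)
    simpa using this

theorem arrayTendsto_of_tendsto_empiricalDiag {B : (n : ℕ) → Matrix (Fin n) (Fin n) ℂ}
    {ν : ProbabilityMeasure ℝ}
    (h : Tendsto (fun n : ℕ => empiricalDiag (B n)) atTop (𝓝 ν.toFiniteMeasure)) :
    ArrayTendsto (fun n i => (B n i i).re) (ν : Measure ℝ) := by
  intro f
  have h1 := FiniteMeasure.tendsto_iff_forall_integral_tendsto.1 h f
  refine h1.congr fun n => ?_
  change ∫ x, f x ∂(((n : ℝ≥0)⁻¹) • ∑ i : Fin n, Measure.dirac (B n i i).re) = _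
  rw [integral_smul_nnreal_measure,
    integral_finsetSum_measure fun i _ => integrable_dirac (by simp)]
  simp [NNReal.smul_def]

theorem eventually_abs_re_le_of_diagLimsup_lt {B : (n : ℕ) → Matrix (Fin n) (Fin n) ℂ} {K : ℝ}
    (h : diagLimsup B < ENNReal.ofReal K) :
    ∀ᶠ n in atTop, ∀ i, |(B n i i).re| ≤ K := by
  filter_upwards [eventually_lt_of_limsup_lt h] with n hn i
  have h1 : ‖B n i i‖ₑ < ENNReal.ofReal K := (le_iSup (fun i => ‖B n i i‖ₑ) i).trans_lt hn
  rw [← ofReal_norm] at h1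
  exact (Complex.abs_re_le_norm _).trans (ENNReal.ofReal_lt_ofReal_iff'.1 h1).1.le

/-- The asymptotic bound on the diagonal entries passes to the limit of their empirical
measures. -/
theorem support_subset_Icc_diagLimsup {B : (n : ℕ) → Matrix (Fin n) (Fin n) ℂ}
    {ν : ProbabilityMeasure ℝ} (hB : diagLimsup B < ∞)
    (h : Tendsto (fun n : ℕ => empiricalDiag (B n)) atTop (𝓝 ν.toFiniteMeasure)) :
    (ν : Measure ℝ).support ⊆ Set.Icc (-(diagLimsup B).toReal) (diagLimsup B).toReal := by
  have key : ∀ K, (diagLimsup B).toReal < K → (ν : Measure ℝ).support ⊆ Set.Icc (-K) K := by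
    intro K hK
    have hK0 : 0 < K := ENNReal.toReal_nonneg.trans_lt hK
    have h1 := eventually_abs_re_le_of_diagLimsup_lt
      ((ENNReal.lt_ofReal_iff_toReal_lt hB.ne).2 hK)
    exact Measure.support_subset_of_isClosed isClosed_Icc
      ((arrayTendsto_of_tendsto_empiricalDiag h).ae_mem_Icc (by linarith)
        (h1.mono fun n hn i => abs_le.1 (hn i)))
  intro x hx
  have h2 : |x| ≤ (diagLimsup B).toReal :=
    le_of_forall_gt_imp_ge_of_dense fun K hK => abs_le.2 (key K hK hx)
  exact abs_le.1 h2

end Model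

theorem exists_convexHull_support_eq_Icc {ν : Measure ℝ} [IsProbabilityMeasure ν] {K : ℝ}
    (hK : ν.support ⊆ Set.Icc (-K) K) :
    ∃ c d : ℝ, c ≤ d ∧ c ∈ ν.support ∧ d ∈ ν.support ∧ convexHull ℝ ν.support = Set.Icc c d := by
  have hcpt : IsCompact ν.support := isCompact_Icc.of_isClosed_subset Measure.isClosed_support hK
  have hne : ν.support.Nonempty := Measure.nonempty_support (IsProbabilityMeasure.ne_zero ν)
  have hc := hcpt.sInf_mem hne
  have hd := hcpt.sSup_mem hne
  have hcd := csInf_le hcpt.bddBelow hd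
  refine ⟨sInf ν.support, sSup ν.support, hcd, hc, hd, ?_⟩
  refine Set.Subset.antisymm (convexHull_min (fun x hx =>
    ⟨csInf_le hcpt.bddBelow hx, le_csSup hcpt.bddAbove hx⟩) (convex_Icc _ _)) ?_
  rw [← segment_eq_Icc hcd]
  exact segment_subset_convexHull hc hd

end HeavyTailedQF

end

theorem mainTheorem1 {Ω : Type*} [MeasurableSpace Ω] (P : Measure Ω) [IsProbabilityMeasure P]
    (α : ℝ) (hα0 : 0 < α) (hα2 : α < 2)
    -- the generic symmetric, regularly varying variable and its iid copies
    (ξ : Ω → ℝ) (hξsymm : IdentDistrib ξ (-ξ) P P)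
    (hξtail : HeavyTailedQF.HasRegularlyVaryingTail P ξ α)
    (X : ℕ → Ω → ℝ) (hXmeas : ∀ j, Measurable (X j)) (hXindep : iIndepFun X P)
    (hXdistrib : ∀ j, IdentDistrib (X j) ξ P P)
    -- random Hermitian matrices, independent of the self-normalized vectors
    (A : (n : ℕ) → Ω → Matrix (Fin n) (Fin n) ℂ)
    (hAmeas : ∀ (n : ℕ) (i j : Fin n), Measurable fun ω => A n ω i j)
    (hAherm : ∀ n ω, (A n ω).IsHermitian)
    (hAindep : ∀ n, IndepFun (fun ω (i j : Fin n) => A n ω i j)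
      (fun ω => HeavyTailedQF.selfNormalized X n ω) P)
    -- the diagonal entries are asymptotically bounded, almost surely
    (hAbdd : ∀ᵐ ω ∂P, HeavyTailedQF.diagLimsup (fun n => A n ω) < ∞)
    -- the empirical measures of the diagonal entries converge weakly, almost surely
    (ν : ProbabilityMeasure ℝ)
    (hAν : ∀ᵐ ω ∂P, Tendsto (fun n : ℕ => HeavyTailedQF.empiricalDiag (A n ω)) atTop
      (𝓝 ν.toFiniteMeasure)) :
    ∃ μ : ProbabilityMeasure ℝ,
      -- convergence in distribution of the diagonal quadratic forms to `μ`
      TendstoInDistribution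
        (fun (n : ℕ) ω => HeavyTailedQF.diagQuadForm
          (HeavyTailedQF.selfNormalized X n ω) (A n ω))
        atTop (id : ℝ → ℝ) (fun _ => P) (μ : Measure ℝ) ∧
      -- the Stieltjes transform of `μ`
      (∀ z : ℂ, z ∉ ((↑) : ℝ → ℂ) '' convexHull ℝ (ν : Measure ℝ).support →
        z ∉ ((↑) : ℝ → ℂ) '' (μ : Measure ℝ).support ∧
        Integrable (fun x : ℝ => (z - (x : ℂ)) ^ ((α : ℂ) / 2 - 1)) (ν : Measure ℝ) ∧
        Integrable (fun x : ℝ => (z - (x : ℂ)) ^ ((α : ℂ) / 2)) (ν : Measure ℝ) ∧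
        ∫ x : ℝ, (z - (x : ℂ)) ^ ((α : ℂ) / 2) ∂(ν : Measure ℝ) ≠ 0 ∧
        HeavyTailedQF.stieltjesTransform (μ : Measure ℝ) z =
          -((∫ x : ℝ, (z - (x : ℂ)) ^ ((α : ℂ) / 2 - 1) ∂(ν : Measure ℝ)) /
            ∫ x : ℝ, (z - (x : ℂ)) ^ ((α : ℂ) / 2) ∂(ν : Measure ℝ))) ∧
      -- the moments of `μ`
      (∀ ℓ : ℕ, 1 ≤ ℓ → Integrable (fun x : ℝ => x ^ ℓ) (μ : Measure ℝ) ∧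
        ∫ x : ℝ, x ^ ℓ ∂(μ : Measure ℝ) = HeavyTailedQF.limitMoment (ν : Measure ℝ) α ℓ) ∧
      -- the moments determine `μ`
      (∀ μ' : ProbabilityMeasure ℝ,
        (∀ ℓ : ℕ, 1 ≤ ℓ → Integrable (fun x : ℝ => x ^ ℓ) (μ' : Measure ℝ) ∧
          ∫ x : ℝ, x ^ ℓ ∂(μ' : Measure ℝ) =
            HeavyTailedQF.limitMoment (ν : Measure ℝ) α ℓ) → μ' = μ) ∧
      -- the support of `μ` lies in `[-M, M]`
      (∀ᵐ ω ∂P, (μ : Measure ℝ).support ⊆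
        Set.Icc (-(HeavyTailedQF.diagLimsup fun n => A n ω).toReal)
          (HeavyTailedQF.diagLimsup fun n => A n ω).toReal) := by
  have hα : 0 < α / 2 := by positivity
  have hα1 : α / 2 < 1 := by linarith
  have hS := HeavyTailedQF.isHeavyTailedSequence_sq hξtail hXmeas hXindep hXdistrib
  -- one good realization of the matrices determines the limit law
  obtain ⟨ω₀, hω₀b, hω₀ν⟩ := (hAbdd.and hAν).exists
  obtain ⟨c, d, hcd, hc, hd, hhull⟩ := HeavyTailedQF.exists_convexHull_support_eq_Icc
    (HeavyTailedQF.support_subset_Icc_diagLimsup hω₀b hω₀ν)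
  have hνcd : ∀ᵐ x ∂(ν : Measure ℝ), x ∈ Set.Icc c d := by
    filter_upwards [Measure.support_mem_ae (μ := (ν : Measure ℝ))] with x hx
    rw [← hhull]
    exact subset_convexHull ℝ _ hx
  obtain ⟨μ, δ, hδ, hμcd, hrel⟩ := HeavyTailedQF.exists_transformRelation hS hα hα1
    (HeavyTailedQF.arrayTendsto_of_tendsto_empiricalDiag hω₀ν) hcd hνcd
  set K₀ := max |c| |d| with hK₀
  have hK₀0 : 0 ≤ K₀ := (abs_nonneg c).trans (le_max_left _ _)
  have habs : ∀ x ∈ Set.Icc c d, |x| ≤ K₀ := fun x hx => abs_le_max_abs_abs hx.1 hx.2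
  have hμK := hμcd.mono habs
  have hνK := hνcd.mono habs
  have hμsupp : (μ : Measure ℝ).support ⊆ Set.Icc c d :=
    Measure.support_subset_of_isClosed isClosed_Icc hμcd
  have hmom : ∀ l : ℕ, 1 ≤ l → Integrable (fun x : ℝ => x ^ l) (μ : Measure ℝ) ∧
      ∫ x : ℝ, x ^ l ∂(μ : Measure ℝ) = HeavyTailedQF.limitMoment (ν : Measure ℝ) α l :=
    fun l hl => ⟨HeavyTailedQF.integrable_pow_of_ae_abs_le hμK l,
      HeavyTailedQF.integral_pow_eq_limitMoment hα0 hα2 hK₀0 hμK hνK hδ hrel hl⟩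
  have hymeas := HeavyTailedQF.measurable_selfNormalized hXmeas
  have hAm : ∀ n, Measurable fun ω (i j : Fin n) => A n ω i j := fun n =>
    measurable_pi_lambda _ fun i => measurable_pi_lambda _ fun j => hAmeas n i j
  have hQm : ∀ n, Measurable fun ω => HeavyTailedQF.diagQuadForm
      (HeavyTailedQF.selfNormalized X n ω) (A n ω) := by
    intro n
    simp_rw [HeavyTailedQF.diagQuadForm_eq_sum]
    exact (HeavyTailedQF.measurable_sum_re_mul_sq n).comp ((hAm n).prodMk (hymeas n))
  refine ⟨μ, ⟨fun n => ?_, aemeasurable_id, ?_⟩, fun z hz => ?_, hmom, fun μ' hμ' => ?_, ?_⟩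
  · exact (hQm n).aemeasurable
  · refine ProbabilityMeasure.tendsto_iff_forall_integral_tendsto.2 fun f => ?_
    have hlim : Tendsto (fun n => ∫ ω, f (HeavyTailedQF.diagQuadForm
        (HeavyTailedQF.selfNormalized X n ω) (A n ω)) ∂P) atTop (𝓝 (∫ x, f x ∂(μ : Measure ℝ))) := by
      simp_rw [HeavyTailedQF.diagQuadForm_eq_sum]
      refine HeavyTailedQF.tendsto_integral_of_indepFun hAm hymeas hAindep
        HeavyTailedQF.measurable_sum_re_mul_sq f ?_
      filter_upwards [hAbdd, hAν] with ω' hb hν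
      obtain ⟨K, hK⟩ := exists_gt (HeavyTailedQF.diagLimsup fun n => A n ω').toReal
      have hbK := HeavyTailedQF.eventually_abs_re_le_of_diagLimsup_lt
        ((ENNReal.lt_ofReal_iff_toReal_lt hb.ne).2 hK)
      have hconv := HeavyTailedQF.tendsto_weightedMeanLaw hα0 hα2 hS
        (HeavyTailedQF.arrayTendsto_of_tendsto_empiricalDiag hν)
        (K := max K K₀) (hK₀0.trans (le_max_right _ _))
        (hbK.mono fun n hn i => (hn i).trans (le_max_left _ _))
        (hμK.mono fun x hx => hx.trans (le_max_right _ _)) hδ hrel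
      have h1 := ProbabilityMeasure.tendsto_iff_forall_integral_tendsto.1 hconv f
      refine h1.congr fun n => ?_
      rw [HeavyTailedQF.integral_weightedMeanLaw]
      congr 1; ext ω
      rw [← HeavyTailedQF.diagQuadForm_selfNormalized X (A n ω') ω,
        HeavyTailedQF.diagQuadForm_eq_sum]
    refine (hlim.congr fun n => ?_).trans (le_of_eq ?_)
    · exact (integral_map (hQm n).aemeasurable
        f.continuous.measurable.aestronglyMeasurable).symm
    · simp
  · rw [hhull] at hz
    have hfor := HeavyTailedQF.stieltjesTransform_eq_of_relation hμcd hνcd hα hα1 hδ hrel hz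
    have hI1 := HeavyTailedQF.integrable_cpow_of_notMem hνcd hz (α / 2)
    have hI2 := HeavyTailedQF.integrable_cpow_of_notMem hνcd hz (α / 2 - 1)
    push_cast at hfor hI1 hI2
    exact ⟨fun h => hz (Set.image_mono hμsupp h), hI2, hI1, hfor.1, hfor.2⟩
  · exact Subtype.ext (HeavyTailedQF.eq_of_forall_integral_pow_eq (μ := (μ : Measure ℝ))
      (μ' := (μ' : Measure ℝ)) hK₀0 hμK (fun l hl => (hμ' l hl).1)
      fun l hl => (hμ' l hl).2.trans (hmom l hl).2.symm)
  · filter_upwards [hAbdd, hAν] with ω hb hν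
    have hsub := HeavyTailedQF.support_subset_Icc_diagLimsup hb hν
    exact hμsupp.trans (Set.Icc_subset_Icc (hsub hc).1 (hsub hd).2)
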